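/- **Setting.** Let $M$ be a smooth $n$-manifold with a pseudo-Riemannian metric $g$ (any signature) and Levi-Civita connection $\nabla$, $V\in C^\infty(M)$ a real potential, $\mu\neq 0$ real, and $\lambda$ a formal parameter. We work in an arbitrary coordinate chart $(x^1,\dots,x^n)$ with domain $U$, and sum over repeated indices. Conventions: $X^a{}_{;b}=(\nabla_bX)^a$; $([\nabla_a,\nabla_b]X)^d=R^d{}_{cab}X^c$; $R_{ecab}=g_{ed}R^d{}_{cab}$; $R_{qr}=R^a{}_{qar}$; $R(X,Y)Z=\nabla_X\nabla_YZ-\nabla_Y\nabla_XZ-\nabla_{[X,Y]_{\rm Lie}}Z$. *The algebra.* $\mathcal D$ is the algebra of operators on $C^\infty(U,\mathbb C)[\lambda]$ generated by $C^\infty(U,\mathbb C)[\lambda]$ (acting by multiplication) and the vector fields $X=X^i\partial_i$, where $\partial_i$ acts as $\lambda\,\partial/\partial x^i$. Thus $f.X=fX$, $[X,f]=\lambda X(f)$, $[X,Y]=\lambda[X,Y]_{\rm Lie}$. Only explicit factors of $\lambda$ count for the order in $\lambda$, so vector fields have order $0$. *The 1-forms.* $\Omega^1$ is the free right $\mathcal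 D$-module on the symbols $dx^i$, $d\partial_i$ ($1\le i\le n$) and $\theta'$. Left products with functions and vector fields are defined by $a\,\eta=\eta\,a+[a,\eta]$, where the commutators $[a,\eta]$, which are linear in $\eta$, are given as follows. The symbol $\theta'$ commutes with everything, and for functions $f$, classical 1-forms $\xi=\xi_i\,dx^i$ and vector fields $X,Y$: - $\widehat\xi=\tfrac12(\xi_i\,dx^i+dx^i\,\xi_i)$ and $df=\widehat{f_{,i}\,dx^i}$; - $[\widehat\xi,f]=\lambda\mu^{-1}g^{ij}\xi_jf_{,i}\,\theta'$; - $[X,\widehat\xi]=\lambda\,\widehat{\nabla_X\xi}-\lambda\mu^{-1}\theta' g^{ij}\xi_i\nabla_jX-\tfrac{\lambda^2}{2\mu}\theta'\big(X^a\xi_pg^{pq}R_{qa}+g^{ij}X^a{}_{;j}\xi_{i;a}\big)$; - $[dX,f]=\lambda\,\widehat{X^a{}_{;i}f_{,a}dx^i}+\lambda\mu^{-1}\theta' g^{ij}f_{,i}\nabla_jX+\tfrac{\lambda^2}{2\mu}\theta'\big(X^af_{,p}g^{pq}R_{qa}+g^{ij}X^a{}_{;j}f_{,i;a}\big)$, where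 $dX=d(X^i)\,\partial_i+X^i\,d\partial_i$; - $[Y,dX]=\lambda\,d(\nabla_YX)+\lambda P(X,Y)$, where $$\begin{aligned}P(X,Y)&=-dx^i\big(\nabla_{\nabla_iX}Y+\nabla_{\nabla_iY}X\big)+\tfrac{\lambda}{2\mu}\theta' g^{ij}\nabla_j\big(\nabla_{\nabla_iX}Y+\nabla_{\nabla_iY}X\big)-\theta' Y^bX^aV_{,a;b}\\ &\quad+\mu^{-1}g^{ij}\theta' Y^bX^cR_{ecbi}g^{ae}(\partial_j\partial_a-\lambda\Gamma^k{}_{aj}\partial_k)-(2\mu)^{-1}g^{ij}\theta'\big(\nabla_iX\,\nabla_jY+\nabla_iY\,\nabla_jX\big)\\ &\quad+\tfrac{\lambda}{2\mu}g^{ij}\theta'\Gamma^k{}_{qj}\big(X^q{}_{;i}\nabla_kY+Y^q{}_{;i}\nabla_kX\big)\\ &\quad+\tfrac\lambda2\big(Y^pX^qR_{qp;i}+X^q{}_{;w}Y^pR^w{}_{piq}+X^qY^p{}_{;w}R^w{}_{qip}\big)\big(dx^i-\mu^{-1}\theta' g^{ij}\partial_j\big)\\ &\quad+\tfrac{\lambda}{2\mu}\theta'\big(Y^pX^q(R_{pi;q}+R_{qi;p}-R_{qp;i})-Y^p{}_{;w}X^qR^w{}_{piq}-X^q{}_{;w}Y^pR^w{}_{qip}\big)g^{ji}\partial_j\\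 &\quad-\tfrac{\lambda}{2\mu}\theta' g^{ij}Y^pR_{pi}\nabla_jX-\tfrac{\lambda}{2\mu}\theta' g^{ij}X^qR_{qi}\nabla_jY.\end{aligned}$$ The relations with $f$ are imposed for $\widehat\xi=dx^i$, $dX=d\partial_i$ and extended to products $dx^i\,a$, $d\partial_i\,a$, $\theta'\,a$ ($a\in\mathcal D$) by the Leibniz rule $[f,\eta\,a]=[f,\eta]\,a+\eta\,[f,a]$. For $[Y,\eta]$, write $\eta$ uniquely as $\eta=dZ+\rho$, where $Z$ is a vector field (with components in $C^\infty(U,\mathbb C)[\lambda]$) and $\rho$ is a sum of products $dx^i\,a$, $\theta'\,a$ and $d\partial_i\,a$, with $a$ in the last case a differential operator annihilating constants; the relation for $[Y,dZ]$ is used on $dZ$, and the Leibniz rule, with the relations for $[Y,dx^i]$ and $[Y,d\partial_i]$, on $\rho$. The Jacobiator is $J(X,Y,\eta)=[X,[Y,\eta]]+[\eta,[X,Y]]+[Y,[\eta,X]]$. **Proposition.** For all smooth real vector fields $X,Y,Z$ on $M$, in every chart and modulo $\lambda^3\Omega^1$, $$\begin{aligned}J(X,Y,dZ)&=\lambda^2\,d(R(X,Y)Z)-\lambda^2\,dx^i\,\nabla_i(R(X,Y)Z)+\lambda^2\,\theta'\,(R(X,Y)Z)^kV_{,k}\\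 &\quad+\lambda^2\big(R^b{}_{rqp;i}X^qY^pZ^r\,\partial_b-R^a{}_{rqi}X^qZ^r\,\nabla_aY-R^a{}_{rip}Y^pZ^r\,\nabla_aX-R^a{}_{iqp}X^qY^p\,\nabla_aZ\big)\big(dx^i-\mu^{-1}g^{ij}\theta'\partial_j\big).\end{aligned}$$ -/

import Mathlib

open scoped Manifold ContDiff Polynomial
open TopologicalSpace

namespace QuantumCalculus

/-! ## Local tensor calculus and the quantum calculus over it

`A` is a commutative algebra of functions on a coordinate patch; in the application it is
`C^∞(U, ℂ)[λ]`, the smooth functions on the patch with a formal parameter `λ` adjoined. -/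

/-- The data entering the construction on a coordinate patch: the coordinate derivatives `∂/∂x^i`,
the deformation parameter `λ`, the metric components `g_{ij}`, the potential `V` and the mass `μ`.
Only the instance `patchData` below, where all of them are the actual objects, is used. -/
structure LocalData (n : ℕ) (A : Type*) [CommRing A] [Algebra ℂ A] where
  /-- the coordinate derivatives -/
  pd : Fin n → Derivation ℂ A A
  /-- the deformation parameter `λ` -/
  lam : A
  /-- the metric components -/
  g : Matrix (Fin n) (Fin n) A
  /-- the potential -/
  V : A
  /-- the mass -/
  mu : ℂ

namespace LocalData

noncomputable section

variable {n : ℕ} {A : Type*} [CommRing A] [Algebra ℂ A] (D : LocalData n A)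

/-! ### Classical tensor calculus -/

/-- The inverse metric `g^{ij}`. -/
def gi (i j : Fin n) : A := (D.g)⁻¹ i j

/-- The Christoffel symbols `Γ^a_{bc}` of the Levi-Civita connection. -/
def Gam (a b c : Fin n) : A :=
  (1 / 2 : ℂ) • ∑ e, D.gi a e * (D.pd b (D.g e c) + D.pd c (D.g e b) - D.pd e (D.g b c))

/-- The Riemann tensor `R^d_{cab}`, with `([∇_a, ∇_b] X)^d = R^d_{cab} X^c`. -/
def Riem (d c a b : Fin n) : A :=
  D.pd a (D.Gam d b c) - D.pd b (D.Gam d a c)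
    + ∑ e, (D.Gam d a e * D.Gam e b c - D.Gam d b e * D.Gam e a c)

/-- The Riemann tensor with all indices down, `R_{ecbi} = g_{ed} R^d_{cbi}`. -/
def RiemLow (e c b i : Fin n) : A := ∑ d, D.g e d * D.Riem d c b i

/-- The Ricci tensor `R_{qr} = R^a_{qar}`. -/
def Ric (q r : Fin n) : A := ∑ a, D.Riem a q a r

/-- `R_{qr;i}`. -/
def dRic (q r i : Fin n) : A :=
  D.pd i (D.Ric q r) - ∑ c, (D.Gam c q i * D.Ric c r + D.Gam c r i * D.Ric q c)

/-- `R^b_{rqp;i}`. -/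
def dRiem (b r q p i : Fin n) : A :=
  D.pd i (D.Riem b r q p)
    + ∑ c, (D.Gam b c i * D.Riem c r q p - D.Gam c r i * D.Riem b c q p
        - D.Gam c q i * D.Riem b r c p - D.Gam c p i * D.Riem b r q c)

/-- `X^a_{;b}` for a vector field `X = X^a ∂_a`. -/
def cd (X : Fin n → A) (a b : Fin n) : A := D.pd b (X a) + ∑ c, X c * D.Gam a c b

/-- `∇_j X = X^a_{;j} ∂_a`. -/
def nab (j : Fin n) (X : Fin n → A) : Fin n → A := fun a => D.cd X a j

/-- `∇_Y X`. -/
def cov (Y X : Fin n → A) : Fin n → A := fun a => ∑ b, Y b * D.cd X a b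

/-- `ξ_{i;a}` for a `1`-form `ξ = ξ_i dx^i`. -/
def cdForm (ξ : Fin n → A) (i a : Fin n) : A := D.pd a (ξ i) - ∑ c, ξ c * D.Gam c i a

/-- `f_{,a;b}`. -/
def hess (f : A) (a b : Fin n) : A := D.pd b (D.pd a f) - ∑ c, D.pd c f * D.Gam c a b

/-- The Lie bracket of vector fields. -/
def lie (X Y : Fin n → A) : Fin n → A :=
  fun b => ∑ a, (X a * D.pd a (Y b) - Y a * D.pd a (X b))

/-- `R(X,Y)Z = ∇_X ∇_Y Z - ∇_Y ∇_X Z - ∇_{[X,Y]} Z`. -/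
def curv (X Y Z : Fin n → A) : Fin n → A :=
  D.cov X (D.cov Y Z) - D.cov Y (D.cov X Z) - D.cov (D.lie X Y) Z

/-! ### The algebra of differential operators -/

/-- The algebra `𝒟` of differential operators with parameter `λ`: it is generated by the functions
and the vector fields `X`, the latter acting as `λ X`, inside the linear endomorphisms of the
functions. The operator `λ ∂/∂x^i` is divisible by `λ` as an endomorphism, but not in `𝒟`, so
vector fields count as having order `0` in `λ`. -/
def diffOp : Subalgebra ℂ (Module.End ℂ A) :=
  Algebra.adjoin ℂ (Set.range (Algebra.lmul ℂ A) ∪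
    Set.range fun i => Algebra.lmul ℂ A D.lam * (D.pd i : A →ₗ[ℂ] A))

/-- The elements of `𝒟`. -/
def DiffOp : Type _ := ↥D.diffOp

instance : Ring D.DiffOp := inferInstanceAs (Ring ↥D.diffOp)

instance : Algebra ℂ D.DiffOp := inferInstanceAs (Algebra ℂ ↥D.diffOp)

variable {D} in
/-- The action of an element of `𝒟` on functions. -/
def act (a : D.DiffOp) : Module.End ℂ A := Subtype.val a

variable {D} in
theorem act_injective : Function.Injective (act : D.DiffOp → Module.End ℂ A) :=
  Subtype.val_injective

/-- A function as an element of `𝒟`. -/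
def fn (f : A) : D.DiffOp :=
  (⟨Algebra.lmul ℂ A f, Algebra.subset_adjoin (Or.inl ⟨f, rfl⟩)⟩ : ↥D.diffOp)

/-- The coordinate vector field `∂_i` as an element of `𝒟`. -/
def P (i : Fin n) : D.DiffOp :=
  (⟨Algebra.lmul ℂ A D.lam * (D.pd i : A →ₗ[ℂ] A), Algebra.subset_adjoin (Or.inr ⟨i, rfl⟩)⟩ :
    ↥D.diffOp)

/-- A vector field `X = X^i ∂_i` as an element of `𝒟`. -/
def vf (X : Fin n → A) : D.DiffOp := ∑ i, D.fn (X i) * D.P i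

/-! ### The 1-forms on the algebra of differential operators -/

/-- The `1`-forms `Ω¹` on `𝒟`: the free right `𝒟`-module on the generators
`dx^i`, `d∂_i` and `θ'`, in this order. -/
abbrev OneForm : Type _ := Fin n ⊕ (Fin n ⊕ Unit) → D.DiffOp

variable {D} in
/-- The right product `η • a` of a `1`-form and an element of `𝒟`. -/
def rmul (η : D.OneForm) (a : D.DiffOp) : D.OneForm := fun k => η k * a

/-- Multiplication of a `1`-form by `λ ^ k` (which is central). -/
def lamPow (k : ℕ) (η : D.OneForm) : D.OneForm := rmul η (D.fn (D.lam ^ k))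

/-- The generator `dx^i`. -/
def dx (i : Fin n) : D.OneForm := Pi.single (Sum.inl i) 1

/-- The generator `d∂_i`. -/
def dP (i : Fin n) : D.OneForm := Pi.single (Sum.inr (Sum.inl i)) 1

/-- The product `θ' • a`, where `θ'` is the extra central generator. -/
def th (a : D.DiffOp) : D.OneForm := Pi.single (Sum.inr (Sum.inr ())) a

/-- The commutator `[f, dx^i] = - λ μ⁻¹ g^{ij} f_{,j} θ'`. -/
def fcommDx (f : A) (i : Fin n) : D.OneForm :=
  -(D.lamPow 1 (D.mu⁻¹ • D.th (D.fn (∑ j, D.gi i j * D.pd j f))))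

/-- `\hat ξ = ½ (ξ_i • dx^i + dx^i • ξ_i)` for `ξ = ξ_i dx^i`,
where `ξ_i • dx^i = dx^i • ξ_i + [ξ_i, dx^i]`. -/
def hat (ξ : Fin n → A) : D.OneForm :=
  ∑ i, (1 / 2 : ℂ) • ((rmul (D.dx i) (D.fn (ξ i)) + D.fcommDx (ξ i) i)
    + rmul (D.dx i) (D.fn (ξ i)))

/-- The differential `df` of a function. -/
def dfn (f : A) : D.OneForm := D.hat fun i => D.pd i f

/-- The right-hand side of the commutation relation for `[dX, f]`,
`λ (X^a_{;i} f_{,a} dx^i)^ + λ μ⁻¹ θ' g^{ij} f_{,i} ∇_j X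
  + λ² (2μ)⁻¹ θ' (X^a f_{,p} g^{pq} R_{qa} + g^{ij} X^a_{;j} f_{,i;a})`. -/
def relDvFn (X : Fin n → A) (f : A) : D.OneForm :=
  D.lamPow 1 (D.hat fun i => ∑ a, D.cd X a i * D.pd a f)
    + D.lamPow 1 (D.mu⁻¹ •
        D.th (∑ i, ∑ j, D.fn (D.gi i j * D.pd i f) * D.vf (D.nab j X)))
    + D.lamPow 2 ((2 * D.mu)⁻¹ • D.th (D.fn
        ((∑ a, ∑ p, ∑ q, X a * D.pd p f * D.gi p q * D.Ric q a)
          + ∑ i, ∑ j, ∑ a, D.gi i j * D.cd X a j * D.hess f i a)))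

/-- The commutator `[f, η]` of a function and a `1`-form: on the generators `dx^i` and `d∂_i` it is
given by the relations, `θ'` is central, and it is extended to `η = Σ (generator) • a`
by the Leibniz rule. -/
def fcomm (f : A) (η : D.OneForm) : D.OneForm :=
  (∑ i, rmul (D.fcommDx f i) (η (Sum.inl i)))
    - (∑ i, rmul (D.relDvFn (Pi.single i 1) f) (η (Sum.inr (Sum.inl i))))
    + fun k => D.fn f * η k - η k * D.fn f

/-- The left product `f • η` of a function and a `1`-form. -/
def lmul (f : A) (η : D.OneForm) : D.OneForm := rmul η (D.fn f) + D.fcomm f η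

/-- The differential `dX = d(X^i) • ∂_i + X^i • d∂_i` of a vector field `X = X^i ∂_i`. -/
def dvf (X : Fin n → A) : D.OneForm :=
  ∑ i, (rmul (D.dfn (X i)) (D.P i) + D.lmul (X i) (D.dP i))

/-! ### The commutation relations with vector fields -/

/-- The right-hand side of the commutation relation for `[X, \hat ξ]`,
`λ (∇_X ξ)^ - λ μ⁻¹ θ' g^{ij} ξ_i ∇_j X
  - λ² (2μ)⁻¹ θ' (X^a ξ_p g^{pq} R_{qa} + g^{ij} X^a_{;j} ξ_{i;a})`. -/
def relVfForm (X ξ : Fin n → A) : D.OneForm :=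
  D.lamPow 1 (D.hat fun i => ∑ a, X a * D.cdForm ξ i a)
    - D.lamPow 1 (D.mu⁻¹ •
        D.th (∑ i, ∑ j, D.fn (D.gi i j * ξ i) * D.vf (D.nab j X)))
    - D.lamPow 2 ((2 * D.mu)⁻¹ • D.th (D.fn
        ((∑ a, ∑ p, ∑ q, X a * ξ p * D.gi p q * D.Ric q a)
          + ∑ i, ∑ j, ∑ a, D.gi i j * D.cd X a j * D.cdForm ξ i a)))

/-- The vector fields `∇_{∇_i X} Y + ∇_{∇_i Y} X`. -/
def symNab (X Y : Fin n → A) (i : Fin n) : Fin n → A :=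
  D.cov (D.nab i X) Y + D.cov (D.nab i Y) X

/-- The kernel form `dx^i - μ⁻¹ θ' g^{ij} ∂_j`. -/
def kerForm (i : Fin n) : D.OneForm :=
  D.dx i - D.mu⁻¹ • D.th (∑ j, D.fn (D.gi i j) * D.P j)

/-- The symmetric `1`-form `P(X,Y)` in the relation `[Y, dX] = λ d(∇_Y X) + λ P(X,Y)`. -/
def PForm (X Y : Fin n → A) : D.OneForm :=
  -(∑ i, rmul (D.dx i) (D.vf (D.symNab X Y i)))
  + D.lamPow 1 ((2 * D.mu)⁻¹ •
      D.th (∑ i, ∑ j, D.fn (D.gi i j) * D.vf (D.nab j (D.symNab X Y i))))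
  - D.th (D.fn (∑ a, ∑ b, Y b * X a * D.hess D.V a b))
  + D.mu⁻¹ • D.th (∑ j, ∑ a,
      D.fn (∑ i, ∑ b, ∑ c, ∑ e, D.gi i j * Y b * X c * D.RiemLow e c b i * D.gi a e)
        * (D.P j * D.P a - D.vf fun k => D.lam * D.Gam k a j))
  - (2 * D.mu)⁻¹ • D.th (∑ i, ∑ j, D.fn (D.gi i j)
      * (D.vf (D.nab i X) * D.vf (D.nab j Y) + D.vf (D.nab i Y) * D.vf (D.nab j X)))
  + D.lamPow 1 ((2 * D.mu)⁻¹ • D.th (∑ i, ∑ j, ∑ k, ∑ q, D.fn (D.gi i j * D.Gam k q j)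
      * (D.fn (D.cd X q i) * D.vf (D.nab k Y) + D.fn (D.cd Y q i) * D.vf (D.nab k X))))
  + D.lamPow 1 ((1 / 2 : ℂ) • ∑ i, D.lmul
      ((∑ p, ∑ q, Y p * X q * D.dRic q p i)
        + ∑ p, ∑ q, ∑ w, (D.cd X q w * Y p * D.Riem w p i q
            + X q * D.cd Y p w * D.Riem w q i p))
      (D.kerForm i))
  + D.lamPow 1 ((2 * D.mu)⁻¹ • D.th (∑ i, ∑ j, D.fn
      (((∑ p, ∑ q, Y p * X q * (D.dRic p i q + D.dRic q i p - D.dRic q p i))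
        - ∑ p, ∑ q, ∑ w, (D.cd Y p w * X q * D.Riem w p i q
            + D.cd X q w * Y p * D.Riem w q i p)) * D.gi j i) * D.P j))
  - D.lamPow 1 ((2 * D.mu)⁻¹ • D.th (∑ i, ∑ j, ∑ p,
      D.fn (D.gi i j * Y p * D.Ric p i) * D.vf (D.nab j X)))
  - D.lamPow 1 ((2 * D.mu)⁻¹ • D.th (∑ i, ∑ j, ∑ q,
      D.fn (D.gi i j * X q * D.Ric q i) * D.vf (D.nab j Y)))

/-- The right-hand side `λ d(∇_Y X) + λ P(X,Y)` of the commutation relation for `[Y, dX]`. -/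
def relVfDv (Y X : Fin n → A) : D.OneForm :=
  D.lamPow 1 (D.dvf (D.cov Y X)) + D.lamPow 1 (D.PForm X Y)

/-- The extension of the commutator `[Y, · ]` from the generators `dx^i`, `d∂_i`, `θ'` to
`η = Σ (generator) • a` by the Leibniz rule. -/
def leibComm (Y : Fin n → A) (η : D.OneForm) : D.OneForm :=
  (∑ i, rmul (D.relVfForm Y (Pi.single i 1)) (η (Sum.inl i)))
    + (∑ i, rmul (D.relVfDv Y (Pi.single i 1)) (η (Sum.inr (Sum.inl i))))
    + fun k => D.vf Y * η k - η k * D.vf Y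

/-- The vector field `Z` such that `η = dZ + ρ`, where the coefficients `a_i` of the `d∂_i • a_i`
in `ρ` have no function part (they consist of terms `b • ∂_j`). The function part of an element
of `𝒟` is its value on the constant function `1`. -/
def dvfPart (η : D.OneForm) : Fin n → A :=
  fun i => act (η (Sum.inr (Sum.inl i))) 1

/-- The commutator `[Y, η]` of a vector field and a `1`-form: writing `η = dZ + ρ` as above,
it is `λ d(∇_Y Z) + λ P(Z,Y)` on `dZ`, and the remaining part `ρ`, made of the products
`dx^i • a`, `θ' • a` and `d∂_i • (b • ∂_j)`, is treated by the Leibniz rule. -/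
def comm (Y : Fin n → A) (η : D.OneForm) : D.OneForm :=
  D.relVfDv Y (D.dvfPart η) + D.leibComm Y (η - D.dvf (D.dvfPart η))

/-- The left product `X • η` of a vector field and a `1`-form. -/
def vmul (X : Fin n → A) (η : D.OneForm) : D.OneForm := rmul η (D.vf X) + D.comm X η

/-- The Jacobiator `J(X,Y,η) = [X,[Y,η]] + [η,[X,Y]] + [Y,[η,X]]` of two vector fields and a
`1`-form; here `[X,Y]` in `𝒟` is the vector field `λ [X,Y]_Lie`, see `vf_commutator`. -/
def jacobiator (X Y : Fin n → A) (η : D.OneForm) : D.OneForm :=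
  D.comm X (D.comm Y η) + -(D.comm (fun i => D.lam * D.lie X Y i) η) + D.comm Y (-(D.comm X η))

/-- The vector-valued coefficients
`R^b_{rqp;i} X^q Y^p Z^r ∂_b - R^a_{rqi} X^q Z^r ∇_a Y - R^a_{rip} Y^p Z^r ∇_a X
  - R^a_{iqp} X^q Y^p ∇_a Z`. -/
def curvCoeff (X Y Z : Fin n → A) (i : Fin n) : Fin n → A :=
  (fun b => ∑ r, ∑ q, ∑ p, D.dRiem b r q p i * X q * Y p * Z r)
    - (∑ a, ∑ r, ∑ q, (D.Riem a r q i * X q * Z r) • D.nab a Y)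
    - (∑ a, ∑ r, ∑ p, (D.Riem a r i p * Y p * Z r) • D.nab a X)
    - (∑ a, ∑ q, ∑ p, (D.Riem a i q p * X q * Y p) • D.nab a Z)

/-! ### The defining relations hold -/

variable {D} in
theorem act_add (a b : D.DiffOp) : act (a + b) = act a + act b := rfl

variable {D} in
theorem act_sub (a b : D.DiffOp) : act (a - b) = act a - act b := rfl

variable {D} in
theorem act_mul (a b : D.DiffOp) (h : A) : act (a * b) h = act a (act b h) := rfl

theorem act_fn (f h : A) : act (D.fn f) h = f * h := rfl

theorem act_P (i : Fin n) (h : A) : act (D.P i) h = D.lam * D.pd i h := rfl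

theorem act_vf (X : Fin n → A) (h : A) :
    act (D.vf X) h = ∑ i, X i * (D.lam * D.pd i h) := by
  have e : act (D.vf X) = ∑ i, act (D.fn (X i) * D.P i) :=
    map_sum (D.diffOp.val : _ →ₐ[ℂ] _) (fun i => D.fn (X i) * D.P i) Finset.univ
  rw [e, LinearMap.sum_apply]
  rfl

theorem fn_mul (f h : A) : D.fn (f * h) = D.fn f * D.fn h :=
  act_injective (map_mul (Algebra.lmul ℂ A) f h)

/-- `f . X = f X`. -/
theorem fn_mul_vf (f : A) (X : Fin n → A) : D.fn f * D.vf X = D.vf (fun i => f * X i) := by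
  simp only [vf, Finset.mul_sum, fn_mul, mul_assoc]

/-- `[X, f] = λ X(f)`. -/
theorem vf_fn_commutator (X : Fin n → A) (f : A) :
    D.vf X * D.fn f - D.fn f * D.vf X = D.fn (D.lam * ∑ i, X i * D.pd i f) := by
  refine act_injective (LinearMap.ext fun h => ?_)
  rw [act_sub, LinearMap.sub_apply]
  simp only [act_mul, act_fn, act_vf, Derivation.leibniz, smul_eq_mul, Finset.mul_sum,
    Finset.sum_mul, ← Finset.sum_sub_distrib]
  exact Finset.sum_congr rfl fun i _ => by ring

/-- `[X, Y] = λ [X, Y]_Lie`. -/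
theorem vf_commutator (hl : ∀ i, D.pd i D.lam = 0)
    (hc : ∀ i j f, D.pd i (D.pd j f) = D.pd j (D.pd i f)) (X Y : Fin n → A) :
    D.vf X * D.vf Y - D.vf Y * D.vf X = D.vf (fun i => D.lam * D.lie X Y i) := by
  refine act_injective (LinearMap.ext fun h => ?_)
  rw [act_sub, LinearMap.sub_apply]
  simp only [act_mul, act_vf, lie, map_sum, Derivation.leibniz, smul_eq_mul, hl, Finset.mul_sum,
    Finset.sum_mul]
  have key : ∑ i, ∑ j, X j * (D.lam * (Y i * (D.lam * D.pd j (D.pd i h))))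
      = ∑ i, ∑ j, Y j * (D.lam * (X i * (D.lam * D.pd j (D.pd i h)))) := by
    rw [Finset.sum_comm]
    refine Finset.sum_congr rfl fun i _ => Finset.sum_congr rfl fun j _ => ?_
    rw [hc i j]
    ring
  simp only [mul_add, Finset.sum_add_distrib, mul_zero, add_zero, key, add_sub_add_left_eq_sub]
  simp only [← Finset.sum_sub_distrib]
  refine Finset.sum_congr rfl fun i _ => Finset.sum_congr rfl fun j _ => ?_
  ring

/-- `[Y, dZ] = λ d(∇_Y Z) + λ P(Z, Y)`. -/
theorem comm_dvf (Y Z : Fin n → A) : D.comm Y (D.dvf Z) =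
    D.lamPow 1 (D.dvf (D.cov Y Z)) + D.lamPow 1 (D.PForm Z Y) := by
  have hth (a : D.DiffOp) (k : Fin n) : D.th a (Sum.inr (Sum.inl k)) = 0 := by simp [th]
  have hfc (f : A) (i k : Fin n) : D.fcommDx f i (Sum.inr (Sum.inl k)) = 0 := by
    simp [fcommDx, lamPow, rmul, hth]
  have hhat (ξ : Fin n → A) (k : Fin n) : D.hat ξ (Sum.inr (Sum.inl k)) = 0 := by
    simp [hat, rmul, hfc, dx]
  have hrel (X : Fin n → A) (f : A) (k : Fin n) :
      D.relDvFn X f (Sum.inr (Sum.inl k)) = 0 := by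
    simp [relDvFn, lamPow, rmul, hth, hhat]
  have hd (k : Fin n) : D.dvf Z (Sum.inr (Sum.inl k)) = D.fn (Z k) := by
    simp only [dvf, Finset.sum_apply, Pi.add_apply, rmul, dfn, hhat, zero_mul, lmul, fcomm,
      Pi.sub_apply, hfc, hrel, Finset.sum_const_zero, zero_add, sub_zero, add_sub_cancel]
    rw [Finset.sum_eq_single k]
    · simp [dP]
    · intro i _ hi
      simp [dP, hi.symm]
    · simp
  have hZ : D.dvfPart (D.dvf Z) = Z := by
    funext k
    rw [dvfPart, hd]
    exact mul_one (Z k)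
  have h0 : D.leibComm Y 0 = 0 := by
    funext k
    simp [leibComm, rmul]
  rw [comm, hZ, sub_self, h0, add_zero, relVfDv]

end

end LocalData

noncomputable section

/-! ## Smooth functions on a coordinate patch -/

section Patch

variable {n : ℕ} (U : Opens (EuclideanSpace ℝ (Fin n)))

open Classical in
/-- Extension of a function on the patch by zero. -/
def extendZero (f : U → ℂ) (x : EuclideanSpace ℝ (Fin n)) : ℂ := if h : x ∈ U then f ⟨x, h⟩ else 0

theorem extendZero_coe (f : U → ℂ) (u : U) : extendZero U f u = f u := by
  simp [extendZero]

/-- The algebra of smooth complex functions on the open set `U`. -/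
def smoothFn : Subalgebra ℂ (U → ℂ) where
  carrier := {f | ContDiffOn ℝ ∞ (extendZero U f) U}
  mul_mem' {f h} hf hh := (ContDiffOn.mul hf hh).congr fun x hx => by
    simp [extendZero, SetLike.mem_coe.1 hx]
  add_mem' {f h} hf hh := (ContDiffOn.add hf hh).congr fun x hx => by
    simp [extendZero, SetLike.mem_coe.1 hx]
  algebraMap_mem' c := (contDiffOn_const (c := c)).congr fun x hx => by
    simp [extendZero, SetLike.mem_coe.1 hx]

/-- The restriction to `U` of a function that is smooth on `U`. -/
def smoothFn.mk' (F : EuclideanSpace ℝ (Fin n) → ℂ) (hF : ContDiffOn ℝ ∞ F U) : smoothFn U :=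
  ⟨fun u => F u, hF.congr fun x hx => by simp [extendZero, SetLike.mem_coe.1 hx]⟩

theorem smoothFn_diff (f : smoothFn U) (u : U) :
    DifferentiableAt ℝ (extendZero U f) (u : EuclideanSpace ℝ (Fin n)) :=
  (f.2.contDiffAt (U.isOpen.mem_nhds u.2)).differentiableAt (by simp)

/-- The partial derivative `∂/∂x^i` as a derivation of the smooth functions on the patch. -/
def partialD (i : Fin n) : Derivation ℂ (smoothFn U) (smoothFn U) :=
  Derivation.mk'
    { toFun := fun f => smoothFn.mk' U
        (fun x => fderiv ℝ (extendZero U f) x (EuclideanSpace.single i 1))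
        ((f.2.fderiv_of_isOpen U.isOpen (by simp)).clm_apply contDiffOn_const)
      map_add' := fun f h => by
        ext u
        have e : extendZero U ((f + h : smoothFn U) : U → ℂ)
            = extendZero U f + extendZero U h := by
          ext x; by_cases hx : x ∈ U <;> simp [extendZero, hx]
        change fderiv ℝ (extendZero U ((f + h : smoothFn U) : U → ℂ)) u _ = _
        rw [e, fderiv_add (smoothFn_diff U f u) (smoothFn_diff U h u)]
        rfl
      map_smul' := fun c f => by
        ext u
        have e : extendZero U ((c • f : smoothFn U) : U → ℂ) = c • extendZero U f := by
          ext x; by_cases hx : x ∈ U <;> simp [extendZero, hx]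
        change fderiv ℝ (extendZero U ((c • f : smoothFn U) : U → ℂ)) u _ = _
        rw [e, fderiv_const_smul (smoothFn_diff U f u)]
        rfl }
    fun f h => by
      ext u
      have e : extendZero U ((f * h : smoothFn U) : U → ℂ)
          = extendZero U f * extendZero U h := by
        ext x; by_cases hx : x ∈ U <;> simp [extendZero, hx]
      change fderiv ℝ (extendZero U ((f * h : smoothFn U) : U → ℂ)) u _ = _
      rw [e, fderiv_mul (smoothFn_diff U f u) (smoothFn_diff U h u)]
      simp only [extendZero_coe, add_apply,
        smul_apply]
      rfl

/-- A derivation applied to the coefficients of polynomials in `λ`. -/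
def coeffDerivation {R : Type*} [CommRing R] [Algebra ℂ R] (d : Derivation ℂ R R) :
    Derivation ℂ R[X] R[X] :=
  (PolynomialModule.equivPolynomialSelf (R := R)).toLinearMap.compDer d.mapCoeffs

/-- The calculus data of the patch `U` with metric `g`, potential `V` and mass `μ`. The functions
are `C^∞(U, ℂ)[λ]`, where `λ` is a formal variable. -/
def patchData (g : Matrix (Fin n) (Fin n) (smoothFn U)) (V : smoothFn U) (μ : ℝ) :
    LocalData n (smoothFn U)[X] where
  pd i := coeffDerivation (partialD U i)
  lam := Polynomial.X
  g := g.map Polynomial.C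
  V := Polynomial.C V
  mu := μ

end Patch

/-! ## Manifolds, metrics, vector fields and their coordinate expressions -/

section Mfld

attribute [local instance] chartedSpaceSelf

variable {E : Type*} [NormedAddCommGroup E] [NormedSpace ℝ E]
  {M : Type*} [TopologicalSpace M] [ChartedSpace E M] [IsManifold 𝓘(ℝ, E) ∞ M]

variable (E M) in
/-- A smooth pseudo-Riemannian metric: a smooth field of nondegenerate symmetric bilinear forms on
the tangent spaces, of arbitrary signature. -/
structure PseudoRiemannianMetric where
  /-- the bilinear form on the tangent space at `p` -/
  inner (p : M) : TangentSpace 𝓘(ℝ, E) p →L[ℝ] TangentSpace 𝓘(ℝ, E) p →L[ℝ] ℝ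
  symm (p : M) (v w : TangentSpace 𝓘(ℝ, E) p) : inner p v w = inner p w v
  nondegenerate (p : M) (v : TangentSpace 𝓘(ℝ, E) p) (hv : ∀ w, inner p v w = 0) : v = 0
  contMDiff : ContMDiff 𝓘(ℝ, E) (𝓘(ℝ, E).prod 𝓘(ℝ, E →L[ℝ] E →L[ℝ] ℝ)) ∞
    (fun p ↦ Bundle.TotalSpace.mk' (E →L[ℝ] E →L[ℝ] ℝ)
      (E := fun p : M ↦ TangentSpace 𝓘(ℝ, E) p →L[ℝ] TangentSpace 𝓘(ℝ, E) p →L[ℝ] ℝ) p (inner p))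

variable (E M) in
/-- A smooth (real) vector field. -/
structure SmoothVectorField where
  /-- the value at `p` -/
  toFun (p : M) : TangentSpace 𝓘(ℝ, E) p
  contMDiff : ContMDiff 𝓘(ℝ, E) 𝓘(ℝ, E).tangent ∞
    (fun p ↦ (⟨p, toFun p⟩ : TangentBundle 𝓘(ℝ, E) M))

variable (E M) in
/-- A chart in the maximal smooth atlas, i.e. a smooth local coordinate system. -/
abbrev SmoothChart : Type _ :=
  {φ : OpenPartialHomeomorph M E // φ ∈ IsManifold.maximalAtlas 𝓘(ℝ, E) ∞ M}

namespace SmoothChart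

/-- The range of the coordinates, an open subset of the model space. -/
def range (φ : SmoothChart E M) : Opens E := ⟨φ.1.target, φ.1.open_target⟩

/-- The tangent vector at the point with coordinates `u` with coordinate expression `e`. -/
def tangentVec (φ : SmoothChart E M) (e : E) (u : E) : TangentSpace 𝓘(ℝ, E) (φ.1.symm u) :=
  mfderiv 𝓘(ℝ, E) 𝓘(ℝ, E) φ.1.symm u e

/-- The coordinate expression of a tangent vector at `p`. -/
def coordVec (φ : SmoothChart E M) (p : M) (v : TangentSpace 𝓘(ℝ, E) p) : E :=
  mfderiv 𝓘(ℝ, E) 𝓘(ℝ, E) φ.1 p v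

theorem contMDiffOn_tangentVec (φ : SmoothChart E M) (e : E) :
    ContMDiffOn 𝓘(ℝ, E) 𝓘(ℝ, E).tangent ∞
      (fun u ↦ (⟨φ.1.symm u, φ.tangentVec e u⟩ : TangentBundle 𝓘(ℝ, E) M)) φ.1.target := by
  have h1 := (contMDiffOn_symm_of_mem_maximalAtlas φ.2).contMDiffOn_tangentMapWithin
    (m := ∞) (by simp) φ.1.open_target.uniqueMDiffOn
  have h2 : ContMDiffOn 𝓘(ℝ, E) 𝓘(ℝ, E).tangent ∞ (fun u : E ↦
      (⟨u, e⟩ : TangentBundle 𝓘(ℝ, E) E)) φ.1.target :=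
    contMDiffOn_vectorSpace_iff_contDiffOn.2 contDiffOn_const
  refine (h1.comp h2 fun u hu => hu).congr fun u hu => ?_
  simp only [Function.comp, tangentMapWithin, tangentVec]
  rw [mfderivWithin_of_isOpen φ.1.open_target hu]

theorem contDiffOn_metric (φ : SmoothChart E M) (g : PseudoRiemannianMetric E M) (e e' : E) :
    ContDiffOn ℝ ∞ (fun u => g.inner (φ.1.symm u) (φ.tangentVec e u) (φ.tangentVec e' u))
      φ.1.target := by
  have h := ContMDiffOn.clm_bundle_apply₂ (F₁ := E) (F₂ := E) (F₃ := ℝ) (E₃ := fun _ : M => ℝ)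
    (g.contMDiff.comp_contMDiffOn (contMDiffOn_symm_of_mem_maximalAtlas φ.2))
    (φ.contMDiffOn_tangentVec e) (φ.contMDiffOn_tangentVec e')
  intro u hu
  have := h u hu
  rw [Bundle.contMDiffWithinAt_totalSpace] at this
  exact contMDiffWithinAt_iff_contDiffWithinAt.1 this.2

theorem contDiffOn_vectorField (φ : SmoothChart E M) (X : SmoothVectorField E M) :
    ContDiffOn ℝ ∞ (fun u => φ.coordVec (φ.1.symm u) (X.toFun (φ.1.symm u))) φ.1.target := by
  have h1 := (contMDiffOn_of_mem_maximalAtlas φ.2).contMDiffOn_tangentMapWithin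
    (m := ∞) (by simp) φ.1.open_source.uniqueMDiffOn
  have h2 := X.contMDiff.comp_contMDiffOn (contMDiffOn_symm_of_mem_maximalAtlas φ.2)
  have h3 := (contMDiff_snd_tangentBundle_modelSpace E 𝓘(ℝ, E)
    (n := ∞)).comp_contMDiffOn (h1.comp h2 fun u hu => φ.1.map_target hu)
  refine (contMDiffOn_iff_contDiffOn.1 h3).congr fun u hu => ?_
  simp only [Function.comp, tangentMapWithin, coordVec]
  rw [mfderivWithin_of_isOpen φ.1.open_source (φ.1.map_target hu)]

end SmoothChart

end Mfld

section Components

variable {n : ℕ} {M : Type*} [TopologicalSpace M] [ChartedSpace (EuclideanSpace ℝ (Fin n)) M]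
  [IsManifold (𝓡 n) ∞ M]

/-- The metric components `g_{ij} = g(∂_i, ∂_j)` in the chart. -/
def SmoothChart.metric (φ : SmoothChart (EuclideanSpace ℝ (Fin n)) M)
    (g : PseudoRiemannianMetric (EuclideanSpace ℝ (Fin n)) M) :
    Matrix (Fin n) (Fin n) (smoothFn φ.range) := fun i j =>
  smoothFn.mk' φ.range
    (fun u => (g.inner (φ.1.symm u) (φ.tangentVec (EuclideanSpace.single i 1) u)
      (φ.tangentVec (EuclideanSpace.single j 1) u) : ℝ))
    (Complex.ofRealCLM.contDiff.comp_contDiffOn (φ.contDiffOn_metric g _ _))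

/-- The components `X^i = dx^i(X)` of a vector field in the chart. -/
def SmoothChart.vectorField (φ : SmoothChart (EuclideanSpace ℝ (Fin n)) M)
    (X : SmoothVectorField (EuclideanSpace ℝ (Fin n)) M) (i : Fin n) : smoothFn φ.range :=
  smoothFn.mk' φ.range
    (fun u => (φ.coordVec (φ.1.symm u) (X.toFun (φ.1.symm u)) i : ℝ))
    (Complex.ofRealCLM.contDiff.comp_contDiffOn
      ((EuclideanSpace.proj i : EuclideanSpace ℝ (Fin n) →L[ℝ] ℝ).contDiff.comp_contDiffOn
        (φ.contDiffOn_vectorField X)))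

/-- The coordinate expression of a smooth function. -/
def SmoothChart.scalar (φ : SmoothChart (EuclideanSpace ℝ (Fin n)) M) (V : C^∞⟮𝓡 n, M; ℝ⟯) :
    smoothFn φ.range :=
  smoothFn.mk' φ.range (fun u => (V (φ.1.symm u) : ℝ)) (by
    have h := V.contMDiff.comp_contMDiffOn (contMDiffOn_symm_of_mem_maximalAtlas φ.2)
    exact Complex.ofRealCLM.contDiff.comp_contDiffOn (contMDiffOn_iff_contDiffOn.1 h))

/-- The calculus on `𝒟` over the coordinate patch given by the chart `φ`. -/
def SmoothChart.calculus (φ : SmoothChart (EuclideanSpace ℝ (Fin n)) M)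
    (g : PseudoRiemannianMetric (EuclideanSpace ℝ (Fin n)) M) (V : C^∞⟮𝓡 n, M; ℝ⟯) (μ : ℝ) :
    LocalData n (smoothFn φ.range)[X] :=
  patchData φ.range (φ.metric g) (φ.scalar V) μ

/-- The components of a vector field in the chart, as functions constant in `λ`. -/
def SmoothChart.comps (φ : SmoothChart (EuclideanSpace ℝ (Fin n)) M)
    (X : SmoothVectorField (EuclideanSpace ℝ (Fin n)) M) : Fin n → (smoothFn φ.range)[X] :=
  fun i => Polynomial.C (φ.vectorField X i)

end Components
end
end QuantumCalculus

namespace QuantumCalculus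

namespace LocalData

open scoped Matrix

noncomputable section

variable {n : ℕ} {A : Type*} [CommRing A] [Algebra ℂ A] (D : LocalData n A)

/-! The relation [Y, dZ] = λ d(∇_Y Z) + λ P(Z,Y) makes the Jacobiator visibly of order λ². Since P
has no d∂_i components, the commutator with it follows the Leibniz rule, and exactly
(`jacobiator_dvf`) J(X,Y,dZ) = λ² (d(R(X,Y)Z) + P(∇_Y Z, X) - P(∇_X Z, Y) - P(Z, [X,Y])) + λ ([X,
P(Z,Y)] - [Y, P(Z,X)]).

The algebra is commutative modulo λ (`mul_comm_modEq`). Hence [X, a]/λ modulo λ depends only on a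
modulo λ (`BracketEq.congr_left`), as a Poisson bracket does, and only the leading symbol of P
matters. This symbol is small: in dx^i it is minus the vector field ∇_{∇_i X} Y + ∇_{∇_i Y} X, and
in θ' it is minus the Hessian of V plus μ⁻¹ times a quadratic form in the ∂_a (`PForm_inl_modEq`,
`PForm_th_modEq`). All the other terms of P carry λ and drop out.

Three tensor identities remain. The dx^i part is `symMat_jacobi`, the potential part is `dir_curv`,
and the quadratic part is `quadMat_jacobi`. They are proved with matrices for ∇X, ∇Y, ∇Z and the
curvature. The inputs are the Ricci identity (`covEnd_cdMat_comm`), both Bianchi identities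
(`Riem_cyclic`, `dRiem_cyclic`), metric compatibility (`covBiv_inv`) and the skewness of R(X,Y)
(`curvEnd_mul_inv`). The quadratic identity holds only up to an antisymmetric matrix, which ∂_a ∂_b
= ∂_b ∂_a annihilates.

In a chart, the hypotheses `IsGeometric` come from the symmetry of second derivatives and the
nondegeneracy of the metric. -/

/-- The properties of coordinate derivatives and metric components on an actual patch. -/
structure IsGeometric : Prop where
  pd_lam : ∀ i, D.pd i D.lam = 0
  pd_comm : ∀ i j f, D.pd i (D.pd j f) = D.pd j (D.pd i f)
  symm : ∀ i j, D.g i j = D.g j i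
  isUnit : IsUnit D.g.det

/-! ### Covariant derivatives in matrix form -/

/-- The connection matrix `Γ^a_{ck}` in the direction `k`. -/
def conn (k : Fin n) : Matrix (Fin n) (Fin n) A := Matrix.of fun a c => D.Gam a c k

/-- The entrywise coordinate derivative of a matrix. -/
def pdMat (k : Fin n) (M : Matrix (Fin n) (Fin n) A) : Matrix (Fin n) (Fin n) A :=
  M.map (D.pd k)

/-- The covariant derivative `X^a_{;b}` as a matrix. -/
def cdMat (X : Fin n → A) : Matrix (Fin n) (Fin n) A := Matrix.of fun a b => D.cd X a b

/-- The covariant derivative of an endomorphism field. -/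
def covEnd (k : Fin n) (M : Matrix (Fin n) (Fin n) A) : Matrix (Fin n) (Fin n) A :=
  D.pdMat k M + D.conn k * M - M * D.conn k

/-- The covariant derivative of a bivector field `M^{ab}`. -/
def covBiv (k : Fin n) (M : Matrix (Fin n) (Fin n) A) : Matrix (Fin n) (Fin n) A :=
  D.pdMat k M + D.conn k * M + M * (D.conn k)ᵀ

/-- The covariant derivative of an endomorphism field along a vector field. -/
def covEndAlong (X : Fin n → A) (M : Matrix (Fin n) (Fin n) A) : Matrix (Fin n) (Fin n) A :=
  ∑ k, X k • D.covEnd k M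

/-- The covariant derivative of a bivector field along a vector field. -/
def covBivAlong (X : Fin n → A) (M : Matrix (Fin n) (Fin n) A) : Matrix (Fin n) (Fin n) A :=
  ∑ k, X k • D.covBiv k M

/-- The curvature endomorphism `R^d_{cqp}` in the coordinate plane `(q, p)`. -/
def riemMat (q p : Fin n) : Matrix (Fin n) (Fin n) A := Matrix.of fun d c => D.Riem d c q p

/-- The curvature endomorphism `R(X, Y)`. -/
def curvEnd (X Y : Fin n → A) : Matrix (Fin n) (Fin n) A :=
  ∑ q, ∑ p, (X q * Y p) • D.riemMat q p

/-- The endomorphism `W ↦ R(W, Y) Z`. -/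
def curvSlot (Y Z : Fin n → A) : Matrix (Fin n) (Fin n) A :=
  Matrix.of fun b i => ∑ c, ∑ a, D.Riem b c i a * Y a * Z c

/-- The endomorphism `W ↦ (∇_W R)(X, Y) Z`. -/
def dCurv (X Y Z : Fin n → A) : Matrix (Fin n) (Fin n) A :=
  Matrix.of fun b i => ∑ r, ∑ q, ∑ p, D.dRiem b r q p i * X q * Y p * Z r

/-- The differential of `f` evaluated on the vector field `X`. -/
def dir (X : Fin n → A) (f : A) : A := ∑ k, X k * D.pd k f

theorem pdMat_add (k : Fin n) (M N : Matrix (Fin n) (Fin n) A) :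
    D.pdMat k (M + N) = D.pdMat k M + D.pdMat k N := by
  ext; simp [pdMat]

theorem pdMat_sub (k : Fin n) (M N : Matrix (Fin n) (Fin n) A) :
    D.pdMat k (M - N) = D.pdMat k M - D.pdMat k N := by
  ext; simp [pdMat]

theorem pdMat_neg (k : Fin n) (M : Matrix (Fin n) (Fin n) A) :
    D.pdMat k (-M) = -D.pdMat k M := by
  ext; simp [pdMat]

theorem pdMat_mul (k : Fin n) (M N : Matrix (Fin n) (Fin n) A) :
    D.pdMat k (M * N) = D.pdMat k M * N + M * D.pdMat k N := by
  ext a b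
  simp only [pdMat, Matrix.map_apply, Matrix.mul_apply, Matrix.add_apply, map_sum,
    Derivation.leibniz, smul_eq_mul, ← Finset.sum_add_distrib]
  exact Finset.sum_congr rfl fun i _ => by ring

theorem pdMat_transpose (k : Fin n) (M : Matrix (Fin n) (Fin n) A) :
    D.pdMat k Mᵀ = (D.pdMat k M)ᵀ := rfl

theorem pdMat_smul (k : Fin n) (f : A) (M : Matrix (Fin n) (Fin n) A) :
    D.pdMat k (f • M) = D.pd k f • M + f • D.pdMat k M := by
  ext; simp [pdMat]; ring

theorem pdMat_sum {ι : Type*} (s : Finset ι) (k : Fin n) (M : ι → Matrix (Fin n) (Fin n) A) :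
    D.pdMat k (∑ i ∈ s, M i) = ∑ i ∈ s, D.pdMat k (M i) := by
  ext; simp [pdMat, Matrix.sum_apply]

theorem pdMat_comm (hD : D.IsGeometric) (i j : Fin n) (M : Matrix (Fin n) (Fin n) A) :
    D.pdMat i (D.pdMat j M) = D.pdMat j (D.pdMat i M) := by
  ext; exact hD.pd_comm _ _ _

theorem covEnd_mul (k : Fin n) (M N : Matrix (Fin n) (Fin n) A) :
    D.covEnd k (M * N) = D.covEnd k M * N + M * D.covEnd k N := by
  simp only [covEnd, pdMat_mul]; noncomm_ring

theorem covEnd_smul (k : Fin n) (f : A) (M : Matrix (Fin n) (Fin n) A) :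
    D.covEnd k (f • M) = D.pd k f • M + f • D.covEnd k M := by
  simp only [covEnd, pdMat_smul, mul_smul_comm, smul_mul_assoc, smul_add, smul_sub]; abel

theorem covEnd_add (k : Fin n) (M N : Matrix (Fin n) (Fin n) A) :
    D.covEnd k (M + N) = D.covEnd k M + D.covEnd k N := by
  simp only [covEnd, pdMat_add]; noncomm_ring

theorem covEnd_sum {ι : Type*} (s : Finset ι) (k : Fin n) (M : ι → Matrix (Fin n) (Fin n) A) :
    D.covEnd k (∑ i ∈ s, M i) = ∑ i ∈ s, D.covEnd k (M i) := by
  simp only [covEnd, pdMat_sum, Finset.mul_sum, Finset.sum_mul, Finset.sum_add_distrib,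
    Finset.sum_sub_distrib]

theorem covEndAlong_add (X : Fin n → A) (M N : Matrix (Fin n) (Fin n) A) :
    D.covEndAlong X (M + N) = D.covEndAlong X M + D.covEndAlong X N := by
  simp only [covEndAlong, covEnd_add, smul_add, Finset.sum_add_distrib]

theorem covEndAlong_mul (X : Fin n → A) (M N : Matrix (Fin n) (Fin n) A) :
    D.covEndAlong X (M * N) = D.covEndAlong X M * N + M * D.covEndAlong X N := by
  simp only [covEndAlong, covEnd_mul, smul_add, Finset.sum_add_distrib, Finset.sum_mul,
    Finset.mul_sum, mul_smul_comm, smul_mul_assoc]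

/-- The connection terms on the contracted inner index cancel, one coming from each factor. -/
theorem covBiv_mul (k : Fin n) (M H : Matrix (Fin n) (Fin n) A) :
    D.covBiv k (M * H) = D.covEnd k M * H + M * D.covBiv k H := by
  simp only [covBiv, covEnd, pdMat_mul]; noncomm_ring

theorem covBiv_transpose (k : Fin n) (H : Matrix (Fin n) (Fin n) A) :
    D.covBiv k Hᵀ = (D.covBiv k H)ᵀ := by
  simp only [covBiv, pdMat_transpose, Matrix.transpose_add, Matrix.transpose_mul,
    Matrix.transpose_transpose]; abel

theorem covBivAlong_mul (X : Fin n → A) (M H : Matrix (Fin n) (Fin n) A) :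
    D.covBivAlong X (M * H) = D.covEndAlong X M * H + M * D.covBivAlong X H := by
  simp only [covBivAlong, covEndAlong, covBiv_mul, smul_add, Finset.sum_add_distrib,
    Finset.sum_mul, Finset.mul_sum, mul_smul_comm, smul_mul_assoc]

theorem covBivAlong_transpose (X : Fin n → A) (H : Matrix (Fin n) (Fin n) A) :
    D.covBivAlong X Hᵀ = (D.covBivAlong X H)ᵀ := by
  simp only [covBivAlong, covBiv_transpose, Matrix.transpose_sum, Matrix.transpose_smul]

theorem covBivAlong_add (X : Fin n → A) (M N : Matrix (Fin n) (Fin n) A) :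
    D.covBivAlong X (M + N) = D.covBivAlong X M + D.covBivAlong X N := by
  simp only [covBivAlong, covBiv, pdMat_add, mul_add, add_mul, ← Finset.sum_add_distrib,
    ← smul_add]
  exact Finset.sum_congr rfl fun _ _ => by congr 1; abel

/-! ### The Levi-Civita connection -/

theorem gi_symm (hD : D.IsGeometric) : (D.g⁻¹)ᵀ = D.g⁻¹ := by
  rw [Matrix.transpose_nonsing_inv]
  congr 1
  ext i j
  exact hD.symm j i

theorem Gam_symm (hD : D.IsGeometric) (a b c : Fin n) : D.Gam a b c = D.Gam a c b := by
  simp only [Gam]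
  congr 1
  refine Finset.sum_congr rfl fun e _ => ?_
  rw [hD.symm b c]; ring

/-- Lowering the first index removes the inverse metric and leaves the Christoffel symbols of the
first kind. -/
theorem g_mul_conn (hD : D.IsGeometric) (k e b : Fin n) : (D.g * D.conn k) e b =
    (1 / 2 : ℂ) • (D.pd b (D.g e k) + D.pd k (D.g e b) - D.pd e (D.g b k)) := by
  have h : D.conn k = (1 / 2 : ℂ) • (D.g⁻¹ * Matrix.of fun e b =>
      (D.pd b (D.g e k) + D.pd k (D.g e b) - D.pd e (D.g b k))) := by
    ext a b
    simp [conn, Gam, gi, Matrix.mul_apply]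
  rw [h, mul_smul_comm, Matrix.mul_nonsing_inv_cancel_left _ _ hD.isUnit]
  rfl

/-- Metric compatibility: in the sum of two Christoffel symbols of the first kind, all but one
derivative of the metric cancel. -/
theorem pdMat_g (hD : D.IsGeometric) (k : Fin n) :
    D.pdMat k D.g = (D.conn k)ᵀ * D.g + D.g * D.conn k := by
  have hs : (D.g)ᵀ = D.g := by ext i j; exact hD.symm j i
  have h : (D.conn k)ᵀ * D.g = (D.g * D.conn k)ᵀ := by rw [Matrix.transpose_mul, hs]
  ext i j
  rw [h, Matrix.add_apply, Matrix.transpose_apply, D.g_mul_conn hD, D.g_mul_conn hD, ← smul_add]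
  simp only [pdMat, Matrix.map_apply]
  rw [hD.symm j i, hD.symm j k, hD.symm i k]
  rw [← smul_right_injective A (two_ne_zero' ℂ) |>.eq_iff, smul_smul, two_smul]
  norm_num
  ring

/-- Differentiate g g⁻¹ = 1 and insert metric compatibility. -/
theorem covBiv_inv (hD : D.IsGeometric) (k : Fin n) : D.covBiv k D.g⁻¹ = 0 := by
  have h1 := congrArg (D.pdMat k) (Matrix.mul_nonsing_inv D.g hD.isUnit)
  have h0 : D.pdMat k (1 : Matrix (Fin n) (Fin n) A) = 0 := by
    have := D.pdMat_mul k (1 : Matrix (Fin n) (Fin n) A) 1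
    simpa using this
  rw [pdMat_mul, h0, D.pdMat_g hD] at h1
  have h2 := congrArg (D.g⁻¹ * ·) h1
  simp only [mul_add, add_mul, mul_zero, ← mul_assoc] at h2
  rw [Matrix.nonsing_inv_mul D.g hD.isUnit, one_mul, one_mul, mul_assoc _ D.g,
    Matrix.mul_nonsing_inv D.g hD.isUnit, mul_one] at h2
  rw [covBiv, ← h2]; abel

theorem covBivAlong_inv (hD : D.IsGeometric) (X : Fin n → A) : D.covBivAlong X D.g⁻¹ = 0 := by
  simp [covBivAlong, D.covBiv_inv hD]

theorem cd_eq (X : Fin n → A) (k : Fin n) :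
    (fun a => D.cd X a k) = (fun a => D.pd k (X a)) + D.conn k *ᵥ X := by
  ext a
  simp [cd, conn, Matrix.mulVec, dotProduct, mul_comm]

theorem cov_eq (X Y : Fin n → A) : D.cov X Y = D.cdMat Y *ᵥ X := by
  ext a
  simp [cov, cdMat, Matrix.mulVec, dotProduct, mul_comm]

theorem lie_eq (hD : D.IsGeometric) (X Y : Fin n → A) : D.lie X Y = D.cov X Y - D.cov Y X := by
  ext b
  simp only [lie, cov, cd, Pi.sub_apply, mul_add, Finset.sum_add_distrib, Finset.sum_sub_distrib,
    Finset.mul_sum]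
  have : ∑ a, ∑ c, X a * (Y c * D.Gam b c a) = ∑ a, ∑ c, Y a * (X c * D.Gam b c a) := by
    rw [Finset.sum_comm]
    refine Finset.sum_congr rfl fun i _ => Finset.sum_congr rfl fun j _ => ?_
    rw [D.Gam_symm hD]; ring
  rw [this]; ring

theorem pd_contract (T X : Fin n → A) (i : Fin n) :
    D.pd i (∑ c, T c * X c) = ∑ c, D.cdForm T c i * X c + ∑ c, T c * D.cd X c i := by
  simp only [map_sum, Derivation.leibniz, smul_eq_mul, cdForm, cd, sub_mul, mul_add,
    Finset.sum_add_distrib, Finset.sum_sub_distrib, Finset.sum_mul, Finset.mul_sum]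
  have : ∑ c, ∑ e, T e * D.Gam e c i * X c = ∑ c, ∑ e, T c * (X e * D.Gam c e i) := by
    rw [Finset.sum_comm]
    exact Finset.sum_congr rfl fun i _ => Finset.sum_congr rfl fun j _ => by ring
  rw [this, Finset.sum_congr rfl fun c _ => mul_comm (X c) (D.pd i (T c))]; ring

theorem cd_mulVec (M : Matrix (Fin n) (Fin n) A) (Z : Fin n → A) (k : Fin n) :
    (fun a => D.cd (M *ᵥ Z) a k) = D.covEnd k M *ᵥ Z + M *ᵥ fun a => D.cd Z a k := by
  have h : (fun a => D.pd k ((M *ᵥ Z) a)) = D.pdMat k M *ᵥ Z + M *ᵥ fun a => D.pd k (Z a) := by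
    ext a
    simp only [Matrix.mulVec, dotProduct, map_sum, Derivation.leibniz, smul_eq_mul, Pi.add_apply,
      pdMat, Matrix.map_apply, ← Finset.sum_add_distrib]
    exact Finset.sum_congr rfl fun i _ => by ring
  rw [cd_eq, cd_eq, h]
  simp only [covEnd, Matrix.add_mulVec, Matrix.sub_mulVec, Matrix.mulVec_add,
    Matrix.mulVec_mulVec]
  abel

/-! ### Curvature -/

theorem Riem_antisymm (d c a b : Fin n) : D.Riem d c a b = -D.Riem d c b a := by
  simp only [Riem, Finset.sum_sub_distrib]; ring

theorem riemMat_antisymm (a b : Fin n) : D.riemMat a b = -D.riemMat b a := by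
  ext d c; exact D.Riem_antisymm d c a b

/-- The form dΓ + Γ ∧ Γ of the curvature. Torsion-freeness is needed because `conn` places the
direction in the last lower slot and `Riem` in the first. -/
theorem riemMat_eq (hD : D.IsGeometric) (a b : Fin n) : D.riemMat a b =
    D.pdMat a (D.conn b) - D.pdMat b (D.conn a) + D.conn a * D.conn b - D.conn b * D.conn a := by
  ext d c
  simp only [riemMat, Matrix.of_apply, Riem, pdMat, conn, Matrix.add_apply, Matrix.sub_apply,
    Matrix.map_apply, Matrix.mul_apply, Finset.sum_sub_distrib, D.Gam_symm hD d a,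
    D.Gam_symm hD d b,
    D.Gam_symm hD _ b c, D.Gam_symm hD _ a c]
  ring

theorem Riem_cyclic (hD : D.IsGeometric) (d c a b : Fin n) :
    D.Riem d c a b + D.Riem d a b c + D.Riem d b c a = 0 := by
  simp only [Riem, Finset.sum_sub_distrib, D.Gam_symm hD _ c b, D.Gam_symm hD _ a b,
    D.Gam_symm hD _ c a]
  ring

theorem curvEnd_antisymm (X Y : Fin n → A) : D.curvEnd X Y = -D.curvEnd Y X := by
  simp only [curvEnd, ← Finset.sum_neg_distrib]
  rw [Finset.sum_comm]
  refine Finset.sum_congr rfl fun p _ => Finset.sum_congr rfl fun q _ => ?_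
  rw [D.riemMat_antisymm q p, smul_neg, mul_comm]

theorem curvSlot_mulVec (X Y Z : Fin n → A) : D.curvSlot Y Z *ᵥ X = D.curvEnd X Y *ᵥ Z := by
  ext b
  simp only [curvSlot, curvEnd, Matrix.mulVec, dotProduct, Matrix.of_apply, Matrix.sum_apply,
    Matrix.smul_apply, riemMat, smul_eq_mul, Finset.sum_mul]
  rw [Finset.sum_comm]
  refine Finset.sum_congr rfl fun c _ => Finset.sum_congr rfl fun i _ =>
    Finset.sum_congr rfl fun a _ => ?_
  ring

theorem curvSlot_sub_left (Y Y' Z : Fin n → A) :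
    D.curvSlot (Y - Y') Z = D.curvSlot Y Z - D.curvSlot Y' Z := by
  ext b i
  simp [curvSlot, mul_sub, sub_mul, Finset.sum_sub_distrib]

/-- First Bianchi identity: R(W,X)Y - R(W,Y)X = -R(X,Y)W. -/
theorem curvSlot_sub_curvSlot (hD : D.IsGeometric) (X Y : Fin n → A) :
    D.curvSlot X Y - D.curvSlot Y X = -D.curvEnd X Y := by
  ext b i
  simp only [curvSlot, curvEnd, Matrix.of_apply, Matrix.sub_apply, Matrix.neg_apply,
    Matrix.sum_apply, Matrix.smul_apply, riemMat, smul_eq_mul]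
  rw [Finset.sum_comm, ← Finset.sum_sub_distrib, ← Finset.sum_neg_distrib]
  refine Finset.sum_congr rfl fun q _ => ?_
  rw [← Finset.sum_sub_distrib, ← Finset.sum_neg_distrib]
  refine Finset.sum_congr rfl fun p _ => ?_
  linear_combination (X q * Y p) * D.Riem_cyclic hD b p i q -
    (X q * Y p) * D.Riem_antisymm b q p i

/-- R(X,Y) is skew for the metric. As g⁻¹ is parallel, its second derivatives can be written with Γ
alone; their symmetry is the integrability condition that R annihilates g⁻¹. -/
theorem curvEnd_mul_inv (hD : D.IsGeometric) (X Y : Fin n → A) :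
    D.g⁻¹ * (D.curvEnd X Y)ᵀ = -(D.curvEnd X Y * D.g⁻¹) := by
  have h1 (k) : D.pdMat k D.g⁻¹ = -(D.conn k * D.g⁻¹) - D.g⁻¹ * (D.conn k)ᵀ := by
    have := D.covBiv_inv hD k
    rw [covBiv] at this
    rw [eq_sub_iff_add_eq, eq_neg_iff_add_eq_zero, ← this]; abel
  have h2 (a b) : D.g⁻¹ * (D.riemMat a b)ᵀ = -(D.riemMat a b * D.g⁻¹) := by
    have h3 := D.pdMat_comm hD a b D.g⁻¹
    simp only [h1, pdMat_sub, pdMat_neg, pdMat_mul, pdMat_transpose] at h3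
    rw [← sub_eq_zero] at h3
    rw [eq_neg_iff_add_eq_zero, ← neg_eq_zero, ← h3, D.riemMat_eq hD]
    simp only [Matrix.transpose_sub, Matrix.transpose_add, Matrix.transpose_mul]
    noncomm_ring
  simp only [curvEnd, Matrix.transpose_sum, Matrix.transpose_smul, Finset.mul_sum,
    Finset.sum_mul, mul_smul_comm, smul_mul_assoc, h2, smul_neg, Finset.sum_neg_distrib]

/-- `covEnd` treats only the two matrix indices, so the Christoffel terms of the plane indices q, p
are left over. -/
theorem covEnd_riemMat (i q p : Fin n) : D.covEnd i (D.riemMat q p) =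
    Matrix.of (fun b r => D.dRiem b r q p i)
      + ∑ c, (D.Gam c q i • D.riemMat c p + D.Gam c p i • D.riemMat q c) := by
  ext b r
  simp only [covEnd, riemMat, dRiem, pdMat, conn, Matrix.add_apply, Matrix.sub_apply,
    Matrix.map_apply, Matrix.of_apply, Matrix.mul_apply, Matrix.sum_apply, Matrix.smul_apply,
    smul_eq_mul, Finset.sum_add_distrib, Finset.sum_sub_distrib, mul_comm (D.Riem _ _ _ _)]
  ring

theorem dRiem_antisymm (b r q p i : Fin n) : D.dRiem b r q p i = -D.dRiem b r p q i := by
  simp only [dRiem, D.Riem_antisymm b r q p, D.Riem_antisymm _ r q p, D.Riem_antisymm b _ q p,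
    D.Riem_antisymm b r q, D.Riem_antisymm b r _ p, map_neg, mul_neg, Finset.sum_sub_distrib,
    Finset.sum_neg_distrib]
  ring

/-- Second Bianchi identity. For matrix-valued connections the cyclic sum vanishes by the curvature
formula and commuting derivatives; the leftover Christoffel terms of the plane indices cancel by
torsion-freeness. -/
theorem dRiem_cyclic (hD : D.IsGeometric) (b r q p i : Fin n) :
    D.dRiem b r q p i + D.dRiem b r p i q + D.dRiem b r i q p = 0 := by
  have h : D.covEnd i (D.riemMat q p) + D.covEnd q (D.riemMat p i)
      + D.covEnd p (D.riemMat i q) = 0 := by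
    simp only [covEnd, D.riemMat_eq hD, pdMat_add, pdMat_sub, pdMat_mul]
    rw [D.pdMat_comm hD i q, D.pdMat_comm hD i p, D.pdMat_comm hD q p]
    noncomm_ring
  rw [covEnd_riemMat, covEnd_riemMat, covEnd_riemMat] at h
  have h' := congrArg (fun M : Matrix (Fin n) (Fin n) A => M b r) h
  simp only [Matrix.add_apply, Matrix.of_apply, Matrix.sum_apply,
    Matrix.smul_apply, riemMat, smul_eq_mul, Finset.sum_add_distrib, D.Riem_antisymm b r q,
    D.Riem_antisymm b r p, D.Riem_antisymm b r i, D.Gam_symm hD _ i p, D.Gam_symm hD _ i q,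
    D.Gam_symm hD _ p q, mul_neg, Finset.sum_neg_distrib, Matrix.zero_apply] at h'
  simp only [D.Riem_antisymm b r _ q, D.Riem_antisymm b r _ p, D.Riem_antisymm b r _ i, mul_neg,
    Finset.sum_neg_distrib] at h'
  linear_combination h'

/-! ### Covariant derivatives of the curvature expressions -/

theorem cdMat_apply (X : Fin n → A) (a b : Fin n) : D.cdMat X a b = D.cd X a b := rfl

theorem cdMat_mulVec (M : Matrix (Fin n) (Fin n) A) (Z : Fin n → A) (b k : Fin n) :
    D.cdMat (M *ᵥ Z) b k = (D.covEnd k M *ᵥ Z) b + (M * D.cdMat Z) b k :=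
  congrFun (D.cd_mulVec M Z k) b

theorem cdMat_sub (X Y : Fin n → A) : D.cdMat (X - Y) = D.cdMat X - D.cdMat Y := by
  ext a b
  simp [cdMat, cd, sub_mul, Finset.sum_sub_distrib]
  ring

/-- The Ricci identity for second covariant derivatives. The term in the first derivative of Z is
symmetric in i and a, so it does not contribute. -/
theorem covEnd_cdMat_comm (hD : D.IsGeometric) (Z : Fin n → A) (b i a : Fin n) :
    D.covEnd i (D.cdMat Z) b a =
      D.covEnd a (D.cdMat Z) b i + (D.riemMat i a *ᵥ Z) b := by
  have h (k a) : D.covEnd k (D.cdMat Z) b a =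
      (fun b => D.pd k (D.cd Z b a)) b + (D.conn k *ᵥ fun c => D.cd Z c a) b
        - ∑ c, D.cd Z b c * D.Gam c a k := rfl
  have h2 (k a) : (fun b => D.pd k (D.cd Z b a)) = (fun b => D.pd k (D.pd a (Z b)))
      + D.pdMat k (D.conn a) *ᵥ Z + D.conn a *ᵥ fun c => D.pd k (Z c) := by
    ext b
    have := congrFun (D.cd_eq Z a) b
    simp only [this, Pi.add_apply, map_add, Matrix.mulVec, dotProduct, map_sum,
      Derivation.leibniz, smul_eq_mul, pdMat, Matrix.map_apply, Finset.sum_add_distrib]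
    simp only [mul_comm (Z _)]
    ring
  rw [h, h, h2, h2, D.riemMat_eq hD, cd_eq, cd_eq]
  simp only [Matrix.mulVec_add, Matrix.add_mulVec, Matrix.sub_mulVec, ← Matrix.mulVec_mulVec,
    Pi.add_apply, Pi.sub_apply, hD.pd_comm i a, D.Gam_symm hD _ i a]
  ring

/-- Product rule for ∇_W(∇_Y Z). The Ricci identity then exchanges the two derivatives of Z, at the
cost of R(W,Y)Z. -/
theorem cdMat_cov (hD : D.IsGeometric) (Y Z : Fin n → A) : D.cdMat (D.cov Y Z) =
    D.cdMat Z * D.cdMat Y + D.covEndAlong Y (D.cdMat Z) + D.curvSlot Y Z := by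
  ext b i
  rw [cov_eq, cdMat_mulVec]
  have h : (D.covEnd i (D.cdMat Z) *ᵥ Y) b =
      D.covEndAlong Y (D.cdMat Z) b i + D.curvSlot Y Z b i := by
    simp only [Matrix.mulVec, dotProduct, D.covEnd_cdMat_comm hD Z b i, covEndAlong,
      Matrix.sum_apply, Matrix.smul_apply, smul_eq_mul, add_mul, Finset.sum_add_distrib, curvSlot,
      Matrix.of_apply, riemMat, Finset.sum_mul]
    rw [Finset.sum_comm (f := fun c a => D.Riem b c i a * Y a * Z c)]
    congr 1
    · exact Finset.sum_congr rfl fun _ _ => mul_comm _ _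
    · exact Finset.sum_congr rfl fun _ _ => Finset.sum_congr rfl fun _ _ => by ring
  rw [h, Matrix.add_apply, Matrix.add_apply]
  ring

/-- By torsion-freeness [X,Y] = ∇_X Y - ∇_Y X; the two curvature terms merge by the first Bianchi
identity. -/
theorem cdMat_lie (hD : D.IsGeometric) (X Y : Fin n → A) : D.cdMat (D.lie X Y) =
    D.cdMat Y * D.cdMat X - D.cdMat X * D.cdMat Y + D.covEndAlong X (D.cdMat Y)
      - D.covEndAlong Y (D.cdMat X) - D.curvEnd X Y := by
  rw [D.lie_eq hD, cdMat_sub, D.cdMat_cov hD, D.cdMat_cov hD, sub_eq_add_neg _ (D.curvEnd X Y),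
    ← D.curvSlot_sub_curvSlot hD]
  abel

theorem covEndAlong_mulVec (X Y : Fin n → A) (M : Matrix (Fin n) (Fin n) A) (b : Fin n) :
    (D.covEndAlong X M *ᵥ Y) b = ∑ k, X k * (D.covEnd k M *ᵥ Y) b := by
  simp only [covEndAlong, Matrix.sum_mulVec, Finset.sum_apply, Matrix.smul_mulVec, Pi.smul_apply,
    smul_eq_mul]

/-- Connects the operator definition of R(X,Y)Z with the components: the second derivatives of Z
differ by the Ricci identity, and the first-order terms cancel against ∇_{[X,Y]} Z. -/
theorem curv_eq (hD : D.IsGeometric) (X Y Z : Fin n → A) :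
    D.curv X Y Z = D.curvEnd X Y *ᵥ Z := by
  have h : D.covEndAlong Y (D.cdMat Z) *ᵥ X + D.curvSlot Y Z *ᵥ X
      = D.covEndAlong X (D.cdMat Z) *ᵥ Y := by
    ext b
    rw [Pi.add_apply, covEndAlong_mulVec, covEndAlong_mulVec]
    have hR : (D.curvSlot Y Z *ᵥ X) b = ∑ k, ∑ a, X k * Y a * (D.riemMat k a *ᵥ Z) b := by
      rw [curvSlot_mulVec]
      simp only [curvEnd, Matrix.sum_mulVec, Matrix.smul_mulVec, Finset.sum_apply, Pi.smul_apply,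
        smul_eq_mul]
    have hX : ∑ k, X k * (D.covEnd k (D.cdMat Z) *ᵥ Y) b
        = ∑ k, ∑ a, X k * Y a * (D.covEnd a (D.cdMat Z) b k + (D.riemMat k a *ᵥ Z) b) := by
      refine Finset.sum_congr rfl fun k _ => ?_
      rw [Matrix.mulVec, dotProduct, Finset.mul_sum]
      refine Finset.sum_congr rfl fun a _ => ?_
      rw [D.covEnd_cdMat_comm hD Z b k a]; ring
    have hY : ∑ k, Y k * (D.covEnd k (D.cdMat Z) *ᵥ X) b
        = ∑ k, ∑ a, X k * Y a * D.covEnd a (D.cdMat Z) b k := by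
      rw [Finset.sum_comm]
      refine Finset.sum_congr rfl fun k _ => ?_
      rw [Matrix.mulVec, dotProduct, Finset.mul_sum]
      exact Finset.sum_congr rfl fun a _ => by ring
    rw [hR, hX, hY]
    simp only [mul_add, Finset.sum_add_distrib]
  have hs : D.curvSlot X Z *ᵥ Y = -(D.curvEnd X Y *ᵥ Z) := by
    rw [curvSlot_mulVec, curvEnd_antisymm, Matrix.neg_mulVec]
  rw [curvSlot_mulVec] at h
  rw [curv, D.cov_eq X (D.cov Y Z), D.cov_eq Y (D.cov X Z), D.cov_eq (D.lie X Y),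
    D.cdMat_cov hD, D.cdMat_cov hD, D.lie_eq hD,
    cov_eq, cov_eq]
  simp only [Matrix.add_mulVec, Matrix.mulVec_sub, Matrix.mulVec_mulVec, ← h, hs,
    curvSlot_mulVec]
  abel

theorem covEnd_curvEnd_apply (X Y : Fin n → A) (k b r : Fin n) : D.covEnd k (D.curvEnd X Y) b r =
    (∑ q, ∑ p, D.dRiem b r q p k * X q * Y p)
      + D.curvEnd (D.nab k X) Y b r + D.curvEnd X (D.nab k Y) b r := by
  simp only [curvEnd, covEnd_sum, covEnd_smul, covEnd_riemMat]
  simp only [Derivation.leibniz, smul_eq_mul, nab, cd, Matrix.sum_apply, Matrix.add_apply, Matrix.smul_apply,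
    Matrix.of_apply, riemMat, mul_add, add_mul, Finset.sum_add_distrib, Finset.mul_sum, Finset.sum_mul]
  have h1 : ∑ q, ∑ p, ∑ c, X q * Y p * (D.Gam c q k * D.Riem b r c p)
      = ∑ q, ∑ p, ∑ c, X c * D.Gam q c k * Y p * D.Riem b r q p := by
    rw [Finset.sum_comm]
    conv_rhs => rw [Finset.sum_comm]
    refine Finset.sum_congr rfl fun p _ => ?_
    rw [Finset.sum_comm]
    exact Finset.sum_congr rfl fun i _ => Finset.sum_congr rfl fun j _ => by ring
  have h2 : ∑ q, ∑ p, ∑ c, X q * Y p * (D.Gam c p k * D.Riem b r q c)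
      = ∑ q, ∑ p, ∑ c, X q * (Y c * D.Gam p c k) * D.Riem b r q p := by
    refine Finset.sum_congr rfl fun p _ => ?_
    rw [Finset.sum_comm]
    exact Finset.sum_congr rfl fun i _ => Finset.sum_congr rfl fun j _ => by ring
  rw [h1, h2]
  simp only [mul_assoc, mul_comm, mul_left_comm]
  ring

/-- Product rule for W ↦ ∇_W(R(X,Y)Z). The minus sign comes from moving ∇_W Y into the first slot of
R. -/
theorem cdMat_curvEnd_mulVec (X Y Z : Fin n → A) : D.cdMat (D.curvEnd X Y *ᵥ Z) =
    D.dCurv X Y Z + D.curvSlot Y Z * D.cdMat X - D.curvSlot X Z * D.cdMat Y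
      + D.curvEnd X Y * D.cdMat Z := by
  ext b i
  have hx : (D.curvSlot Y Z * D.cdMat X) b i = (D.curvEnd (D.nab i X) Y *ᵥ Z) b := by
    rw [← curvSlot_mulVec]; rfl
  have hy : (D.curvSlot X Z * D.cdMat Y) b i = -(D.curvEnd X (D.nab i Y) *ᵥ Z) b := by
    rw [curvEnd_antisymm, Matrix.neg_mulVec, ← curvSlot_mulVec, Pi.neg_apply, neg_neg]; rfl
  rw [cdMat_mulVec, Matrix.add_apply, Matrix.sub_apply, Matrix.add_apply, hx, hy]
  simp only [Matrix.mulVec, dotProduct, covEnd_curvEnd_apply, add_mul, Finset.sum_add_distrib,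
    dCurv, Matrix.of_apply, Finset.sum_mul]
  ring

/-- The column i is R(∂_i, Y)Z, so the product rule for R applies. The derivative of ∂_i it produces
is exactly what `covEnd` subtracts for the lower index. -/
theorem covEnd_curvSlot_apply (Y Z : Fin n → A) (k b i : Fin n) :
    D.covEnd k (D.curvSlot Y Z) b i = D.dCurv (Pi.single i 1) Y Z b k
      + D.curvSlot (D.nab k Y) Z b i + D.curvSlot Y (D.nab k Z) b i := by
  have hs (Y Z : Fin n → A) : D.curvSlot Y Z b i = (D.curvEnd (Pi.single i 1) Y *ᵥ Z) b := by
    rw [← curvSlot_mulVec]; simp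
  have hcol : (fun b => D.curvSlot Y Z b i) = D.curvEnd (Pi.single i 1) Y *ᵥ Z := by
    rw [← curvSlot_mulVec]; ext; simp
  have h : D.covEnd k (D.curvSlot Y Z) b i =
      D.cd (fun b => D.curvSlot Y Z b i) b k - ∑ c, D.curvSlot Y Z b c * D.Gam c i k := by
    simp only [covEnd, cd, pdMat, conn, Matrix.add_apply, Matrix.sub_apply, Matrix.map_apply,
      Matrix.mul_apply, Matrix.of_apply, mul_comm (D.Gam b _ k)]
  have hx : ∑ c, D.curvSlot Y Z b c * D.Gam c i k
      = (D.curvSlot Y Z * D.cdMat (Pi.single i 1)) b k := by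
    rw [Matrix.mul_apply]
    refine Finset.sum_congr rfl fun c _ => ?_
    have : D.pd k ((Pi.single i 1 : Fin n → A) c) = 0 := by
      rcases eq_or_ne c i with rfl | h <;> simp [*]
    rw [cdMat_apply, cd, this]
    simp [Pi.single_apply]
  have hy : (D.curvSlot (Pi.single i 1) Z * D.cdMat Y) b k = -D.curvSlot (D.nab k Y) Z b i := by
    rw [hs, curvEnd_antisymm, Matrix.neg_mulVec, ← curvSlot_mulVec, Pi.neg_apply, neg_neg]; rfl
  have hz : (D.curvEnd (Pi.single i 1) Y * D.cdMat Z) b k = D.curvSlot Y (D.nab k Z) b i := by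
    rw [hs]; rfl
  rw [h, hcol, hx, ← cdMat_apply, cdMat_curvEnd_mulVec]
  simp only [Matrix.add_apply, Matrix.sub_apply, hy, hz]
  ring

/-- Second Bianchi identity in the form (∇_X R)(W,Y)Z - (∇_Y R)(W,X)Z = (∇_W R)(X,Y)Z. The
derivatives falling on Y and X combine into [X,Y]. -/
theorem covEndAlong_curvSlot_sub (hD : D.IsGeometric) (X Y Z : Fin n → A) :
    D.covEndAlong X (D.curvSlot Y Z) - D.covEndAlong Y (D.curvSlot X Z) =
      D.dCurv X Y Z + D.curvSlot (D.lie X Y) Z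
        + D.curvSlot Y (D.cov X Z) - D.curvSlot X (D.cov Y Z) := by
  ext b i
  have h (X Y) : D.covEndAlong X (D.curvSlot Y Z) b i =
      ∑ k, X k * D.dCurv (Pi.single i 1) Y Z b k + D.curvSlot (D.cov X Y) Z b i
        + D.curvSlot Y (D.cov X Z) b i := by
    simp only [covEndAlong, Matrix.sum_apply, Matrix.smul_apply, smul_eq_mul,
      covEnd_curvSlot_apply, mul_add, Finset.sum_add_distrib]
    have h1 : ∑ k, X k * D.curvSlot (D.nab k Y) Z b i = D.curvSlot (D.cov X Y) Z b i := by
      simp only [curvSlot, Matrix.of_apply, nab, cov, Finset.mul_sum, Finset.sum_mul]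
      rw [Finset.sum_comm]
      refine Finset.sum_congr rfl fun _ _ => ?_
      rw [Finset.sum_comm]
      exact Finset.sum_congr rfl fun _ _ => Finset.sum_congr rfl fun _ _ => by ring
    have h2 : ∑ k, X k * D.curvSlot Y (D.nab k Z) b i = D.curvSlot Y (D.cov X Z) b i := by
      simp only [curvSlot, Matrix.of_apply, nab, cov, Finset.mul_sum]
      rw [Finset.sum_comm]
      refine Finset.sum_congr rfl fun _ _ => ?_
      rw [Finset.sum_comm]
      exact Finset.sum_congr rfl fun _ _ => Finset.sum_congr rfl fun _ _ => by ring
    rw [h1, h2]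
  have h2 : ∑ k, X k * D.dCurv (Pi.single i 1) Y Z b k - ∑ k, Y k * D.dCurv (Pi.single i 1) X Z b k
      = D.dCurv X Y Z b i := by
    have h3 (X Y : Fin n → A) : ∑ k, X k * D.dCurv (Pi.single i 1) Y Z b k =
        ∑ r, ∑ q, ∑ p, X q * Y p * Z r * D.dRiem b r i p q := by
      have h5 (k : Fin n) : D.dCurv (Pi.single i 1) Y Z b k =
          ∑ r, ∑ p, D.dRiem b r i p k * Y p * Z r := by
        rw [dCurv, Matrix.of_apply]
        refine Finset.sum_congr rfl fun r _ => ?_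
        rw [Finset.sum_eq_single i (fun q _ hq => by simp [hq]) (by simp)]
        simp
      simp only [h5, Finset.mul_sum]
      rw [Finset.sum_comm]
      exact Finset.sum_congr rfl fun _ _ => Finset.sum_congr rfl fun _ _ =>
        Finset.sum_congr rfl fun _ _ => by ring
    have h4 : ∑ r, ∑ q, ∑ p, Y q * X p * Z r * D.dRiem b r i p q
        = ∑ r, ∑ q, ∑ p, X q * Y p * Z r * D.dRiem b r i q p := by
      refine Finset.sum_congr rfl fun r _ => ?_
      rw [Finset.sum_comm]
      exact Finset.sum_congr rfl fun _ _ => Finset.sum_congr rfl fun _ _ => by ring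
    rw [h3, h3, h4, dCurv, Matrix.of_apply]
    simp only [← Finset.sum_sub_distrib]
    refine Finset.sum_congr rfl fun r _ => Finset.sum_congr rfl fun q _ =>
      Finset.sum_congr rfl fun p _ => ?_
    linear_combination (X q * Y p * Z r) * (D.dRiem_antisymm b r i p q
      - D.dRiem_cyclic hD b r q p i)
  simp only [Matrix.add_apply, Matrix.sub_apply, h, D.lie_eq hD, curvSlot_sub_left, ← h2]
  ring

/-! ### The Hessian -/

theorem hess_contract (f : A) (Y Z : Fin n → A) :
    ∑ a, ∑ b, Y b * Z a * D.hess f a b = D.dir Y (D.dir Z f) - D.dir (D.cov Y Z) f := by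
  have h (b) : D.pd b (D.dir Z f) = ∑ a, Z a * D.hess f a b + ∑ a, D.cd Z a b * D.pd a f := by
    have := D.pd_contract (fun a => D.pd a f) Z b
    simp only [dir, mul_comm (Z _), mul_comm (D.cd _ _ _)]
    exact this
  have hY : D.dir Y (D.dir Z f) = ∑ b, Y b * D.pd b (D.dir Z f) := rfl
  rw [hY]
  simp only [dir.eq_def _ (D.cov Y Z), cov, Finset.sum_mul]
  rw [Finset.sum_comm, Finset.sum_comm (f := fun k b => Y b * D.cd Z k b * D.pd k f),
    ← Finset.sum_sub_distrib]
  refine Finset.sum_congr rfl fun b _ => ?_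
  rw [h, mul_add, Finset.mul_sum, Finset.mul_sum]
  simp only [mul_assoc, add_sub_cancel_right]

theorem dir_lie (hD : D.IsGeometric) (X Y : Fin n → A) (f : A) :
    D.dir (D.lie X Y) f = D.dir X (D.dir Y f) - D.dir Y (D.dir X f) := by
  simp only [dir, lie, map_sum, Derivation.leibniz, smul_eq_mul, Finset.mul_sum, Finset.sum_mul,
    sub_mul, mul_add, Finset.sum_add_distrib, Finset.sum_sub_distrib]
  have h1 : ∑ a, ∑ b, X a * (Y b * D.pd a (D.pd b f))
      = ∑ a, ∑ b, Y a * (X b * D.pd a (D.pd b f)) := by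
    rw [Finset.sum_comm]
    refine Finset.sum_congr rfl fun i _ => Finset.sum_congr rfl fun j _ => ?_
    rw [hD.pd_comm i j]; ring
  have h2 (X Y : Fin n → A) : ∑ a, ∑ b, X b * D.pd b (Y a) * D.pd a f
      = ∑ a, ∑ b, X a * (D.pd b f * D.pd a (Y b)) := by
    rw [Finset.sum_comm]
    exact Finset.sum_congr rfl fun i _ => Finset.sum_congr rfl fun j _ => by ring
  rw [h1, h2, h2]; ring

/-- Each Hessian is Y(Zf) - (∇_Y Z)f. The third-order terms cancel against [X,Y](Zf), and the mixed
ones cancel in pairs. With f = V this gives the potential term of the Jacobiator. -/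
theorem dir_curv (hD : D.IsGeometric) (f : A) (X Y Z : Fin n → A) :
    D.dir (D.curv X Y Z) f =
      - (∑ a, ∑ b, X b * D.cov Y Z a * D.hess f a b) + (∑ a, ∑ b, Y b * D.cov X Z a * D.hess f a b)
      + (∑ a, ∑ b, D.lie X Y b * Z a * D.hess f a b)
      - D.dir X (∑ a, ∑ b, Y b * Z a * D.hess f a b)
      + D.dir Y (∑ a, ∑ b, X b * Z a * D.hess f a b) := by
  have h (X Y f) : D.dir (X - Y) f = D.dir X f - D.dir Y f := by
    simp [dir, sub_mul]
  have h' (X f g) : D.dir X (f - g) = D.dir X f - D.dir X g := by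
    simp [dir, mul_sub]
  simp only [hess_contract, curv, h, h', D.dir_lie hD]
  ring

/-! ### The symbol of the Jacobiator -/

/-- The endomorphism `W ↦ ∇_{∇_W X} Y + ∇_{∇_W Y} X`. -/
def symMat (X Y : Fin n → A) : Matrix (Fin n) (Fin n) A :=
  D.cdMat Y * D.cdMat X + D.cdMat X * D.cdMat Y

theorem symNab_apply (X Y : Fin n → A) (i b : Fin n) : D.symNab X Y i b = D.symMat X Y b i := by
  rw [symNab, cov_eq, cov_eq]; rfl

/-- The endomorphism field with columns `curvCoeff`. -/
def curvCoeffMat (X Y Z : Fin n → A) : Matrix (Fin n) (Fin n) A :=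
  D.dCurv X Y Z + D.cdMat Y * D.curvSlot X Z - D.cdMat X * D.curvSlot Y Z
    - D.cdMat Z * D.curvEnd X Y

theorem curvCoeff_apply (X Y Z : Fin n → A) (i b : Fin n) :
    D.curvCoeff X Y Z i b = D.curvCoeffMat X Y Z b i := by
  have hx : (D.cdMat X * D.curvSlot Y Z) b i = ∑ a, ∑ r, ∑ p, D.Riem a r i p * Y p * Z r *
      D.cd X b a := by
    simp only [Matrix.mul_apply, curvSlot, cdMat, Matrix.of_apply, mul_comm (D.cd _ _ _),
      Finset.sum_mul]
  have hy : (D.cdMat Y * D.curvSlot X Z) b i = -∑ a, ∑ r, ∑ q, D.Riem a r q i * X q * Z r *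
      D.cd Y b a := by
    simp only [Matrix.mul_apply, curvSlot, cdMat, Matrix.of_apply, mul_comm (D.cd _ _ _),
      Finset.sum_mul, D.Riem_antisymm _ _ _ i, neg_mul, Finset.sum_neg_distrib, neg_neg]
  have hz : (D.cdMat Z * D.curvEnd X Y) b i = ∑ a, ∑ q, ∑ p, D.Riem a i q p * X q * Y p *
      D.cd Z b a := by
    simp only [Matrix.mul_apply, curvEnd, cdMat, Matrix.of_apply, mul_comm (D.cd _ _ _),
      Finset.sum_mul, Matrix.sum_apply, Matrix.smul_apply, riemMat, smul_eq_mul]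
    exact Finset.sum_congr rfl fun _ _ => Finset.sum_congr rfl fun _ _ =>
      Finset.sum_congr rfl fun _ _ => by ring
  simp only [curvCoeffMat, Matrix.add_apply, Matrix.sub_apply, hx, hy, hz, curvCoeff,
    Pi.sub_apply, Finset.sum_apply, Pi.smul_apply, nab, smul_eq_mul, dCurv, Matrix.of_apply]
  ring

/-- The Lie derivative of an endomorphism field, up to the term `S (∂X)`. -/
def lieEnd (X : Fin n → A) (S : Matrix (Fin n) (Fin n) A) : Matrix (Fin n) (Fin n) A :=
  D.covEndAlong X S - D.cdMat X * S

/-- The right side is what the algebra yields: X brackets with each column, while [X, dx^i] acts on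
the form index through Christoffel symbols. Torsion-freeness identifies this with a tensor
expression. -/
theorem lieEnd_apply (hD : D.IsGeometric) (X : Fin n → A) (S : Matrix (Fin n) (Fin n) A)
    (b i : Fin n) : D.lieEnd X S b i =
      D.lie X (fun a => S a i) b - ∑ k, (∑ a, X a * D.Gam k i a) * S b k := by
  simp only [lieEnd, covEndAlong, covEnd, cdMat, lie, cd, Matrix.sub_apply, Matrix.add_apply,
    Matrix.sum_apply, Matrix.smul_apply, Matrix.mul_apply, Matrix.of_apply, pdMat,
    Matrix.map_apply, conn, smul_eq_mul, mul_sub, mul_add, add_mul, Finset.sum_add_distrib,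
    Finset.sum_sub_distrib, Finset.mul_sum, Finset.sum_mul]
  have h1 : ∑ k, ∑ a, X k * (D.Gam b a k * S a i) = ∑ a, ∑ c, X c * D.Gam b c a * S a i := by
    rw [Finset.sum_comm]
    refine Finset.sum_congr rfl fun _ _ => Finset.sum_congr rfl fun _ _ => ?_
    rw [D.Gam_symm hD]; ring
  have h2 : ∑ k, ∑ a, X k * (S b a * D.Gam a i k) = ∑ a, ∑ k, X k * D.Gam a i k * S b a := by
    rw [Finset.sum_comm]
    exact Finset.sum_congr rfl fun _ _ => Finset.sum_congr rfl fun _ _ => by ring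
  have h3 : ∑ a, D.pd a (X b) * S a i = ∑ a, S a i * D.pd a (X b) :=
    Finset.sum_congr rfl fun _ _ => mul_comm _ _
  rw [h1, h2, h3]; ring

/-- The Lie derivative of a bivector field. -/
def lieBiv (X : Fin n → A) (M : Matrix (Fin n) (Fin n) A) : Matrix (Fin n) (Fin n) A :=
  D.covBivAlong X M - D.cdMat X * M - M * (D.cdMat X)ᵀ

/-- Torsion-freeness removes the connection, which leaves the coordinate formula produced by
brackets with ∂_a ∂_b. -/
theorem lieBiv_eq (hD : D.IsGeometric) (X : Fin n → A) (M : Matrix (Fin n) (Fin n) A) :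
    D.lieBiv X M = ∑ k, X k • D.pdMat k M - Matrix.of (fun b a => D.pd a (X b)) * M
      - M * (Matrix.of fun b a => D.pd a (X b))ᵀ := by
  have h : D.cdMat X = Matrix.of (fun b a => D.pd a (X b)) + ∑ k, X k • D.conn k := by
    ext b a
    simp only [cdMat, cd, conn, Matrix.of_apply, Matrix.add_apply, Matrix.sum_apply,
      Matrix.smul_apply, smul_eq_mul]
    congr 1
    exact Finset.sum_congr rfl fun k _ => by rw [D.Gam_symm hD]
  simp only [lieBiv, covBivAlong, covBiv, h, add_mul, mul_add, Matrix.transpose_add,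
    Matrix.transpose_sum, Matrix.transpose_smul, smul_add, Finset.sum_add_distrib, Finset.sum_mul,
    Finset.mul_sum, smul_mul_assoc, mul_smul_comm]
  abel

/-- The bivector field whose quadratic form is the leading symbol of the `θ'` part of `PForm`. -/
def quadMat (X Y : Fin n → A) : Matrix (Fin n) (Fin n) A :=
  -(D.curvSlot Y X * D.g⁻¹ + D.cdMat X * D.g⁻¹ * (D.cdMat Y)ᵀ)

/-- The dx^i part. After expansion, the derivatives of ∇X, ∇Y, ∇Z and the products of three
gradients cancel as noncommuting polynomials; only curvature survives. -/
theorem symMat_jacobi (hD : D.IsGeometric) (X Y Z : Fin n → A) :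
    -D.symMat (D.cov Y Z) X + D.symMat (D.cov X Z) Y + D.symMat Z (D.lie X Y)
      - D.lieEnd X (D.symMat Z Y) + D.lieEnd Y (D.symMat Z X)
    = -D.cdMat (D.curv X Y Z) + D.curvCoeffMat X Y Z := by
  rw [D.curv_eq hD, cdMat_curvEnd_mulVec]
  simp only [symMat, lieEnd, curvCoeffMat, D.cdMat_cov hD, D.cdMat_lie hD, covEndAlong_add,
    covEndAlong_mul]
  noncomm_ring

/-- The quadratic θ' part. Only the symmetric part of these matrices affects the operator, so
equality up to some K - Kᵀ suffices. -/
theorem quadMat_jacobi (hD : D.IsGeometric) (X Y Z : Fin n → A) :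
    ∃ K, D.quadMat (D.cov Y Z) X - D.quadMat (D.cov X Z) Y - D.quadMat Z (D.lie X Y)
      + D.lieBiv X (D.quadMat Z Y) - D.lieBiv Y (D.quadMat Z X)
      + D.cdMat X * D.g⁻¹ * (D.symMat Z Y)ᵀ - D.cdMat Y * D.g⁻¹ * (D.symMat Z X)ᵀ
    = -(D.curvCoeffMat X Y Z * D.g⁻¹) + (K - Kᵀ) := by
  have hn (X : Fin n → A) (M) : D.covBivAlong X (-M) = -D.covBivAlong X M := by
    rw [eq_neg_iff_add_eq_zero, ← covBivAlong_add, neg_add_cancel]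
    simp [covBivAlong, covBiv, pdMat]
  have ht (X Y Z : Fin n → A) : D.covBivAlong X (D.cdMat Z * D.g⁻¹ * (D.cdMat Y)ᵀ) =
      D.covEndAlong X (D.cdMat Z) * D.g⁻¹ * (D.cdMat Y)ᵀ
        + D.cdMat Z * D.g⁻¹ * (D.covEndAlong X (D.cdMat Y))ᵀ := by
    have : D.covBivAlong X (D.g⁻¹ * (D.cdMat Y)ᵀ) = D.g⁻¹ * (D.covEndAlong X (D.cdMat Y))ᵀ := by
      have h := D.covBivAlong_transpose X (D.cdMat Y * D.g⁻¹)
      rwa [covBivAlong_mul, D.covBivAlong_inv hD, mul_zero, add_zero, Matrix.transpose_mul,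
        Matrix.transpose_mul, D.gi_symm hD] at h
    rw [mul_assoc, covBivAlong_mul, this]
    simp only [mul_assoc]
  -- K collects products of three gradients that survive the expansion; each occurs together with
  -- minus its transpose.
  refine ⟨-(D.cdMat Z * D.cdMat Y * D.g⁻¹ * (D.cdMat X)ᵀ)
    + D.cdMat Z * D.cdMat X * D.g⁻¹ * (D.cdMat Y)ᵀ + D.cdMat X * D.cdMat Z * D.g⁻¹ * (D.cdMat Y)ᵀ
    - D.cdMat Y * D.cdMat Z * D.g⁻¹ * (D.cdMat X)ᵀ, ?_⟩
  -- The curvature inside ∇[X,Y] appears transposed; skewness moves it to the left of g⁻¹.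
  have hR : D.cdMat Z * D.g⁻¹ * (D.curvEnd X Y)ᵀ = -(D.cdMat Z * D.curvEnd X Y * D.g⁻¹) := by
    rw [mul_assoc, D.curvEnd_mul_inv hD, mul_neg, mul_assoc]
  have hS := congrArg (· * D.g⁻¹) (D.covEndAlong_curvSlot_sub hD X Y Z)
  simp only [sub_mul, add_mul] at hS
  simp only [quadMat, lieBiv, symMat, curvCoeffMat, D.cdMat_cov hD, D.cdMat_lie hD, hn,
    covBivAlong_add, ht, covBivAlong_mul, D.covBivAlong_inv hD, mul_zero, add_zero]
  simp only [Matrix.transpose_add, Matrix.transpose_sub, Matrix.transpose_mul,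
    Matrix.transpose_neg, Matrix.transpose_transpose, D.gi_symm hD, mul_add, mul_sub, add_mul,
    sub_mul, mul_neg, neg_mul, hR, ← mul_assoc]
  rw [← sub_eq_zero] at hS ⊢
  rw [← neg_eq_zero, ← hS]
  abel

/-! ### The algebra of differential operators to leading order -/

/-- Functions as elements of `𝒟`, as an algebra homomorphism. -/
def fnHom : A →ₐ[ℂ] D.DiffOp :=
  (Algebra.lmul ℂ A).codRestrict D.diffOp fun f => (D.fn f).2

theorem fn_one : D.fn 1 = 1 := map_one D.fnHom

theorem fn_zero : D.fn 0 = 0 := map_zero D.fnHom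

theorem fn_add (f h : A) : D.fn (f + h) = D.fn f + D.fn h := map_add D.fnHom f h

theorem fn_sub (f h : A) : D.fn (f - h) = D.fn f - D.fn h := map_sub D.fnHom f h

theorem fn_neg (f : A) : D.fn (-f) = -D.fn f := map_neg D.fnHom f

theorem fn_pow (f : A) (k : ℕ) : D.fn (f ^ k) = D.fn f ^ k := map_pow D.fnHom f k

theorem fn_sum {ι : Type*} (s : Finset ι) (f : ι → A) :
    D.fn (∑ i ∈ s, f i) = ∑ i ∈ s, D.fn (f i) := map_sum D.fnHom f s

theorem fn_mul_comm (f h : A) : D.fn f * D.fn h = D.fn h * D.fn f := by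
  rw [← fn_mul, mul_comm, fn_mul]

theorem vf_add (X Y : Fin n → A) : D.vf (X + Y) = D.vf X + D.vf Y := by
  simp only [vf, Pi.add_apply, fn_add, add_mul, Finset.sum_add_distrib]

theorem vf_neg (X : Fin n → A) : D.vf (-X) = -D.vf X := by
  simp only [vf, Pi.neg_apply, fn_neg, neg_mul, Finset.sum_neg_distrib]

theorem vf_sub (X Y : Fin n → A) : D.vf (X - Y) = D.vf X - D.vf Y := by
  simp only [vf, Pi.sub_apply, fn_sub, sub_mul, Finset.sum_sub_distrib]

theorem vf_smul (f : A) (X : Fin n → A) : D.vf (f • X) = D.fn f * D.vf X :=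
  (D.fn_mul_vf f X).symm

theorem vf_sum {ι : Type*} (s : Finset ι) (X : ι → Fin n → A) :
    D.vf (∑ i ∈ s, X i) = ∑ i ∈ s, D.vf (X i) := by
  simp only [vf, Finset.sum_apply, fn_sum, Finset.sum_mul]
  exact Finset.sum_comm

theorem vf_single (i : Fin n) : D.vf (Pi.single i 1) = D.P i := by
  rw [vf, Finset.sum_eq_single i (fun j _ hj => by simp [hj, fn_zero]) (by simp)]
  simp [fn_one]

/-- Scalars are constant functions, so functions and the ∂_i are the only base cases. -/
theorem diffOp_induction {p : D.DiffOp → Prop} (hfn : ∀ f, p (D.fn f)) (hP : ∀ i, p (D.P i))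
    (hadd : ∀ a b, p a → p b → p (a + b)) (hmul : ∀ a b, p a → p b → p (a * b))
    (a : D.DiffOp) : p a := by
  obtain ⟨a, ha⟩ := a
  induction ha using Algebra.adjoin_induction with
  | mem x hx =>
    rcases hx with ⟨f, rfl⟩ | ⟨i, rfl⟩
    · exact hfn f
    · exact hP i
  | algebraMap r =>
    exact (congrArg p (D.fnHom.commutes r)).mp (hfn (algebraMap ℂ A r))
  | add x y hx hy h1 h2 => exact hadd _ _ h1 h2
  | mul x y hx hy h1 h2 => exact hmul _ _ h1 h2

theorem P_fn (i : Fin n) (f : A) :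
    D.P i * D.fn f = D.fn f * D.P i + D.fn D.lam * D.fn (D.pd i f) := by
  have h := D.vf_fn_commutator (Pi.single i 1) f
  rw [vf_single, sub_eq_iff_eq_add, fn_mul] at h
  rw [h, add_comm, Finset.sum_eq_single i (fun j _ hj => by simp [hj]) (by simp)]
  simp

theorem P_comm (hD : D.IsGeometric) (i j : Fin n) : D.P i * D.P j = D.P j * D.P i := by
  refine act_injective (LinearMap.ext fun h => ?_)
  simp only [act_mul, act_P, Derivation.leibniz, smul_eq_mul, hD.pd_lam, hD.pd_comm i j]
  ring

/-- Functions whose coordinate derivatives vanish are central in `𝒟`. -/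
theorem fn_central {c : A} (hc : ∀ i, D.pd i c = 0) (a : D.DiffOp) :
    a * D.fn c = D.fn c * a := by
  induction a using D.diffOp_induction with
  | hfn f => exact D.fn_mul_comm f c
  | hP i => rw [P_fn, hc, fn_zero, mul_zero, add_zero]
  | hadd a b ha hb => rw [add_mul, mul_add, ha, hb]
  | hmul a b ha hb => rw [mul_assoc, hb, ← mul_assoc, ha, mul_assoc]

/-- The parameter `λ` as an element of `𝒟`. -/
def lamOp : D.DiffOp := D.fn D.lam

theorem lamOp_central (hD : D.IsGeometric) (a : D.DiffOp) : a * D.lamOp = D.lamOp * a :=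
  D.fn_central hD.pd_lam a

theorem lamOp_pow_central (hD : D.IsGeometric) (m : ℕ) (a : D.DiffOp) :
    a * D.lamOp ^ m = D.lamOp ^ m * a :=
  ((show Commute a D.lamOp from D.lamOp_central hD a).pow_right m).eq

/-- Congruence modulo `λ ^ m` in `𝒟`. -/
def ModEq (m : ℕ) (a b : D.DiffOp) : Prop := ∃ c, a - b = D.lamOp ^ m * c

namespace ModEq

variable {D} {m : ℕ} {a b c d : D.DiffOp}

theorem of_eq (h : a = b) : D.ModEq m a b := ⟨0, by simp [h]⟩

theorem refl (m : ℕ) (a : D.DiffOp) : D.ModEq m a a := of_eq rfl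

theorem symm (h : D.ModEq m a b) : D.ModEq m b a := by
  obtain ⟨x, h⟩ := h
  exact ⟨-x, by rw [mul_neg, ← h, neg_sub]⟩

theorem trans (h : D.ModEq m a b) (h' : D.ModEq m b c) : D.ModEq m a c := by
  obtain ⟨x, h⟩ := h
  obtain ⟨y, h'⟩ := h'
  exact ⟨x + y, by rw [mul_add, ← h, ← h', sub_add_sub_cancel]⟩

theorem add (h : D.ModEq m a b) (h' : D.ModEq m c d) : D.ModEq m (a + c) (b + d) := by
  obtain ⟨x, h⟩ := h
  obtain ⟨y, h'⟩ := h'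
  exact ⟨x + y, by rw [mul_add, ← h, ← h']; abel⟩

theorem neg (h : D.ModEq m a b) : D.ModEq m (-a) (-b) := by
  obtain ⟨x, h⟩ := h
  exact ⟨-x, by rw [mul_neg, ← h]; abel⟩

theorem sub (h : D.ModEq m a b) (h' : D.ModEq m c d) : D.ModEq m (a - c) (b - d) := by
  rw [sub_eq_add_neg, sub_eq_add_neg]
  exact h.add h'.neg

theorem sum {ι : Type*} {s : Finset ι} {f g : ι → D.DiffOp}
    (h : ∀ i ∈ s, D.ModEq m (f i) (g i)) : D.ModEq m (∑ i ∈ s, f i) (∑ i ∈ s, g i) := by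
  choose! x hx using h
  exact ⟨∑ i ∈ s, x i, by rw [Finset.mul_sum, ← Finset.sum_sub_distrib, Finset.sum_congr rfl hx]⟩

theorem smul (r : ℂ) (h : D.ModEq m a b) : D.ModEq m (r • a) (r • b) := by
  obtain ⟨x, h⟩ := h
  exact ⟨r • x, by rw [mul_smul_comm, ← h, smul_sub]⟩

theorem mul_right (h : D.ModEq m a b) (c : D.DiffOp) : D.ModEq m (a * c) (b * c) := by
  obtain ⟨x, h⟩ := h
  exact ⟨x * c, by rw [← mul_assoc, ← h, sub_mul]⟩

theorem mul_left (hD : D.IsGeometric) (h : D.ModEq m a b) (c : D.DiffOp) :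
    D.ModEq m (c * a) (c * b) := by
  obtain ⟨x, h⟩ := h
  exact ⟨c * x, by rw [← mul_assoc, ← D.lamOp_pow_central hD, mul_assoc, ← h, mul_sub]⟩

theorem mul (hD : D.IsGeometric) (h : D.ModEq m a b) (h' : D.ModEq m c d) :
    D.ModEq m (a * c) (b * d) :=
  (h.mul_right c).trans (h'.mul_left hD b)

theorem lamOp_pow_mul (k : ℕ) (h : D.ModEq m a b) :
    D.ModEq (k + m) (D.lamOp ^ k * a) (D.lamOp ^ k * b) := by
  obtain ⟨x, h⟩ := h
  exact ⟨x, by rw [← mul_sub, h, pow_add, mul_assoc]⟩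

theorem lamOp_mul (h : D.ModEq m a b) : D.ModEq (m + 1) (D.lamOp * a) (D.lamOp * b) := by
  simpa [add_comm] using h.lamOp_pow_mul 1

end ModEq

theorem modEq_zero (m : ℕ) (a : D.DiffOp) : D.ModEq m (D.lamOp ^ m * a) 0 := ⟨a, sub_zero _⟩

theorem modEq_one_zero (a : D.DiffOp) : D.ModEq 1 (D.lamOp * a) 0 := by
  simpa using D.modEq_zero 1 a

/-- `𝒟` is commutative modulo `λ`. -/
theorem mul_comm_modEq (hD : D.IsGeometric) (a b : D.DiffOp) : D.ModEq 1 (a * b) (b * a) := by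
  have hmul (a b c : D.DiffOp) (ha : D.ModEq 1 (a * c) (c * a)) (hb : D.ModEq 1 (b * c) (c * b)) :
      D.ModEq 1 (a * b * c) (c * (a * b)) := by
    have h1 := hb.mul_left hD a
    have h2 := ha.mul_right b
    rw [← mul_assoc, ← mul_assoc] at h1
    exact h1.trans (h2.trans (.of_eq (mul_assoc _ _ _)))
  have hadd (a b c : D.DiffOp) (ha : D.ModEq 1 (a * c) (c * a)) (hb : D.ModEq 1 (b * c) (c * b)) :
      D.ModEq 1 ((a + b) * c) (c * (a + b)) := by
    rw [add_mul, mul_add]; exact ha.add hb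
  -- Among generators, only ∂_i and f fail to commute, and their commutator λ f_{,i} is divisible by
  -- λ inside the algebra.
  have hPf (i f) : D.ModEq 1 (D.P i * D.fn f) (D.fn f * D.P i) :=
    ⟨D.fn (D.pd i f), by rw [P_fn, add_sub_cancel_left, pow_one]; rfl⟩
  induction a using D.diffOp_induction with
  | hadd a a' ha ha' => exact hadd _ _ _ ha ha'
  | hmul a a' ha ha' => exact hmul _ _ _ ha ha'
  | hfn f =>
    refine ModEq.symm ?_
    induction b using D.diffOp_induction with
    | hadd a a' ha ha' => exact hadd _ _ _ ha ha'
    | hmul a a' ha ha' => exact hmul _ _ _ ha ha'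
    | hfn h => exact .of_eq (D.fn_mul_comm _ _)
    | hP i => exact hPf i f
  | hP i =>
    refine ModEq.symm ?_
    induction b using D.diffOp_induction with
    | hadd a a' ha ha' => exact hadd _ _ _ ha ha'
    | hmul a a' ha ha' => exact hmul _ _ _ ha ha'
    | hfn h => exact (hPf i h).symm
    | hP j => exact .of_eq (D.P_comm hD _ _)

/-- `[X, a] = λ d` modulo `λ²`. -/
def BracketEq (X : Fin n → A) (a d : D.DiffOp) : Prop :=
  D.ModEq 2 (D.vf X * a - a * D.vf X) (D.lamOp * d)

namespace BracketEq

variable {D} {X : Fin n → A} {a b d e : D.DiffOp}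

theorem congr_right (h : D.BracketEq X a d) (hd : D.ModEq 1 d e) : D.BracketEq X a e :=
  h.trans hd.lamOp_mul

/-- If b = a + λx then [X,b] = [X,a] + λ[X,x], and [X,x] is itself divisible by λ. Hence lower-order
symbols never enter. -/
theorem congr_left (hD : D.IsGeometric) (h : D.BracketEq X a d) (hb : D.ModEq 1 b a) :
    D.BracketEq X b d := by
  obtain ⟨x, hx⟩ := hb
  obtain rfl := sub_eq_iff_eq_add.1 hx
  have h1 := (D.mul_comm_modEq hD (D.vf X) x).sub (.refl 1 (x * D.vf X))
  rw [sub_self] at h1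
  have h2 := h1.lamOp_mul.add h
  rw [mul_zero, zero_add] at h2
  refine ModEq.trans (.of_eq ?_) h2
  rw [pow_one, mul_add, add_mul, ← mul_assoc, D.lamOp_central hD, mul_sub, mul_assoc, mul_assoc]
  abel

theorem add (h : D.BracketEq X a d) (h' : D.BracketEq X b e) : D.BracketEq X (a + b) (d + e) := by
  refine ModEq.trans (.of_eq ?_) ((ModEq.add h h').trans (.of_eq (mul_add _ _ _).symm))
  rw [mul_add, add_mul]; abel

theorem neg (h : D.BracketEq X a d) : D.BracketEq X (-a) (-d) := by
  refine ModEq.trans (.of_eq ?_) ((ModEq.neg h).trans (.of_eq (mul_neg _ _).symm))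
  rw [mul_neg, neg_mul]; abel

theorem smul (r : ℂ) (h : D.BracketEq X a d) : D.BracketEq X (r • a) (r • d) := by
  refine ModEq.trans (.of_eq ?_) ((ModEq.smul r h).trans (.of_eq (mul_smul_comm _ _ _).symm))
  rw [mul_smul_comm, smul_mul_assoc, smul_sub]

theorem sum {ι : Type*} {s : Finset ι} {f g : ι → D.DiffOp}
    (h : ∀ i ∈ s, D.BracketEq X (f i) (g i)) :
    D.BracketEq X (∑ i ∈ s, f i) (∑ i ∈ s, g i) := by
  refine ModEq.trans (.of_eq ?_) ((ModEq.sum h).trans (.of_eq (Finset.mul_sum _ _ _).symm))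
  rw [Finset.mul_sum, Finset.sum_mul, Finset.sum_sub_distrib]

theorem mul (hD : D.IsGeometric) (h : D.BracketEq X a d) (h' : D.BracketEq X b e) :
    D.BracketEq X (a * b) (d * b + a * e) := by
  have h1 := (ModEq.mul_right h b).add (ModEq.mul_left hD h' a)
  refine ModEq.trans (.of_eq ?_) (h1.trans (.of_eq ?_))
  · noncomm_ring
  · rw [mul_add, ← mul_assoc a, D.lamOp_central hD]; noncomm_ring

end BracketEq

theorem bracketEq_fn (X : Fin n → A) (f : A) : D.BracketEq X (D.fn f) (D.fn (D.dir X f)) :=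
  .of_eq (by rw [vf_fn_commutator, fn_mul]; rfl)

theorem bracketEq_vf (hD : D.IsGeometric) (X Y : Fin n → A) :
    D.BracketEq X (D.vf Y) (D.vf (D.lie X Y)) :=
  .of_eq (by rw [D.vf_commutator hD.pd_lam hD.pd_comm, ← fn_mul_vf]; rfl)

theorem bracketEq_P (hD : D.IsGeometric) (X : Fin n → A) (i : Fin n) :
    D.BracketEq X (D.P i) (-D.vf fun b => D.pd i (X b)) := by
  have h := D.bracketEq_vf hD X (Pi.single i 1)
  have hl : D.lie X (Pi.single i 1) = -fun b => D.pd i (X b) := by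
    ext b
    have (a : Fin n) : D.pd a ((Pi.single i 1 : Fin n → A) b) = 0 := by
      rcases eq_or_ne b i with rfl | h <;> simp [*]
    simp only [lie, this]
    simp [Pi.single_apply]
  rwa [vf_single, hl, vf_neg] at h

/-- The quadratic expression `M^{ab} ∂_a ∂_b`. -/
def quad (M : Matrix (Fin n) (Fin n) A) : D.DiffOp :=
  ∑ a, ∑ b, D.fn (M a b) * (D.P a * D.P b)

theorem quad_add (M N : Matrix (Fin n) (Fin n) A) : D.quad (M + N) = D.quad M + D.quad N := by
  simp only [quad, Matrix.add_apply, fn_add, add_mul, Finset.sum_add_distrib]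

theorem quad_neg (M : Matrix (Fin n) (Fin n) A) : D.quad (-M) = -D.quad M := by
  simp only [quad, Matrix.neg_apply, fn_neg, neg_mul, Finset.sum_neg_distrib]

theorem quad_sub (M N : Matrix (Fin n) (Fin n) A) : D.quad (M - N) = D.quad M - D.quad N := by
  rw [sub_eq_add_neg, quad_add, quad_neg, sub_eq_add_neg]

theorem quad_sum {ι : Type*} (s : Finset ι) (f : ι → Matrix (Fin n) (Fin n) A) :
    D.quad (∑ i ∈ s, f i) = ∑ i ∈ s, D.quad (f i) := by
  induction s using Finset.cons_induction with
  | empty => simp [quad, fn_zero]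
  | cons a s ha ih => rw [Finset.sum_cons, Finset.sum_cons, quad_add, ih]

theorem quad_transpose (hD : D.IsGeometric) (M : Matrix (Fin n) (Fin n) A) :
    D.quad Mᵀ = D.quad M := by
  simp only [quad, Matrix.transpose_apply]
  rw [Finset.sum_comm]
  refine Finset.sum_congr rfl fun a _ => Finset.sum_congr rfl fun b _ => ?_
  rw [D.P_comm hD]

/-- `f (Y ⬝ Z)` is `f Y^a Z^b ∂_a ∂_b` modulo `λ`. -/
theorem fn_mul_vf_mul_vf (hD : D.IsGeometric) (f : A) (Y Z : Fin n → A) :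
    D.ModEq 1 (D.fn f * (D.vf Y * D.vf Z)) (D.quad (Matrix.of fun a b => f * Y a * Z b)) := by
  simp only [vf, Finset.mul_sum, Finset.sum_mul, quad, Matrix.of_apply]
  rw [Finset.sum_comm]
  refine ModEq.sum fun a _ => ModEq.sum fun b _ => ?_
  have h := (D.mul_comm_modEq hD (D.P a) (D.fn (Z b))).mul_right (D.P b)
  refine (ModEq.of_eq ?_).trans ((h.mul_left hD (D.fn f * D.fn (Y a))).trans (.of_eq ?_))
  · simp only [mul_assoc]
  · rw [fn_mul, fn_mul]; simp only [mul_assoc]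

/-- [X, ·] is a derivation: it differentiates the coefficients and replaces each ∂_a by -(∂_a
X^c)∂_c. Reordering the factors costs only terms of higher order in λ. -/
theorem bracketEq_quad (hD : D.IsGeometric) (X : Fin n → A) (M : Matrix (Fin n) (Fin n) A) :
    D.BracketEq X (D.quad M) (D.quad (D.lieBiv X M)) := by
  have h : D.BracketEq X (D.quad M) (∑ a, ∑ b, (D.fn (D.dir X (M a b)) * (D.P a * D.P b)
      + D.fn (M a b) * ((-D.vf fun c => D.pd a (X c)) * D.P b
        + D.P a * (-D.vf fun c => D.pd b (X c))))) :=
    .sum fun a _ => .sum fun b _ => (D.bracketEq_fn X _).mul hD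
      ((D.bracketEq_P hD X a).mul hD (D.bracketEq_P hD X b))
  refine h.congr_right ?_
  have h1 (a b : Fin n) : D.ModEq 1 (D.fn (M a b) * ((D.vf fun c => D.pd a (X c)) * D.P b))
      (D.quad (Matrix.of fun c e => M a b * D.pd a (X c) * (Pi.single b 1 : Fin n → A) e)) := by
    rw [← vf_single]
    exact D.fn_mul_vf_mul_vf hD _ _ _
  have h2 (a b : Fin n) : D.ModEq 1 (D.fn (M a b) * (D.P a * D.vf fun c => D.pd b (X c)))
      (D.quad (Matrix.of fun c e => M a b * (Pi.single a 1 : Fin n → A) c * D.pd b (X e))) := by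
    rw [← vf_single]
    exact D.fn_mul_vf_mul_vf hD _ _ _
  have h3 : D.ModEq 1 (∑ a, ∑ b, (D.fn (D.dir X (M a b)) * (D.P a * D.P b)
      + D.fn (M a b) * ((-D.vf fun c => D.pd a (X c)) * D.P b
        + D.P a * (-D.vf fun c => D.pd b (X c)))))
      (∑ a, ∑ b, (D.fn (D.dir X (M a b)) * (D.P a * D.P b)
        - D.quad (Matrix.of fun c e => M a b * D.pd a (X c) * (Pi.single b 1 : Fin n → A) e)
        - D.quad (Matrix.of fun c e => M a b * (Pi.single a 1 : Fin n → A) c * D.pd b (X e)))) := by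
    refine .sum fun a _ => .sum fun b _ => ?_
    rw [sub_sub, sub_eq_add_neg, neg_mul, mul_neg, ← neg_add, mul_neg, mul_add]
    exact (ModEq.refl _ _).add ((h1 a b).add (h2 a b)).neg
  refine h3.trans (.of_eq ?_)
  simp only [Finset.sum_sub_distrib, ← quad_sum, D.lieBiv_eq hD, quad_sub]
  congr 1
  · congr 1
    · simp only [quad, Matrix.sum_apply, Matrix.smul_apply]; rfl
    · congr 1
      ext c e
      simp only [Matrix.sum_apply, Matrix.of_apply, Matrix.mul_apply, Pi.single_apply, mul_ite,
        mul_one, mul_zero, Finset.sum_ite_eq, Finset.mem_univ, if_true, mul_comm (M _ _)]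
  · congr 1
    ext c e
    simp only [Matrix.sum_apply, Matrix.of_apply, Matrix.mul_apply, Pi.single_apply, mul_ite,
      mul_one, mul_zero, Matrix.transpose_apply, ite_mul, zero_mul]
    rw [Finset.sum_comm]
    simp

/-! ### The structure maps of the 1-forms -/

theorem lamPow_eq (hD : D.IsGeometric) (k : ℕ) (η : D.OneForm) :
    D.lamPow k η = D.lamOp ^ k • η := by
  ext i
  rw [lamPow, rmul, fn_pow, ← lamOp, D.lamOp_pow_central hD]
  rfl

theorem lamPow_one_eq (hD : D.IsGeometric) (η : D.OneForm) : D.lamPow 1 η = D.lamOp • η := by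
  rw [D.lamPow_eq hD, pow_one]

/-! ### Homogeneity in constant functions -/

/-- Homogeneity is used for the constants λ and -λ. As λ is an element of `A` and not a complex
number, ℂ-linearity does not give it; it rests on the vanishing of the derivatives of c and the
resulting centrality of c. -/
theorem cd_const_smul {c : A} (hc : ∀ i, D.pd i c = 0) (X : Fin n → A) (a b : Fin n) :
    D.cd (c • X) a b = c * D.cd X a b := by
  simp only [cd, Pi.smul_apply, smul_eq_mul, Derivation.leibniz, hc, mul_zero, add_zero, mul_add,
    Finset.mul_sum, mul_assoc]

theorem nab_const_smul {c : A} (hc : ∀ i, D.pd i c = 0) (j : Fin n) (X : Fin n → A) :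
    D.nab j (c • X) = c • D.nab j X := by
  ext a; exact D.cd_const_smul hc X a j

theorem cov_const_smul {c : A} (hc : ∀ i, D.pd i c = 0) (Y X : Fin n → A) :
    D.cov Y (c • X) = c • D.cov Y X := by
  ext a
  simp only [cov, D.cd_const_smul hc, Pi.smul_apply, smul_eq_mul, Finset.mul_sum, mul_left_comm]

theorem cov_smul (c : A) (Y X : Fin n → A) : D.cov (c • Y) X = c • D.cov Y X := by
  ext a
  simp only [cov, Pi.smul_apply, smul_eq_mul, Finset.mul_sum, mul_assoc]

theorem symNab_const_smul_left {c : A} (hc : ∀ i, D.pd i c = 0) (X Y : Fin n → A) (i : Fin n) :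
    D.symNab (c • X) Y i = c • D.symNab X Y i := by
  simp only [symNab, D.nab_const_smul hc, D.cov_const_smul hc, cov_smul, smul_add]

theorem symNab_const_smul_right {c : A} (hc : ∀ i, D.pd i c = 0) (X Y : Fin n → A) (i : Fin n) :
    D.symNab X (c • Y) i = c • D.symNab X Y i := by
  simp only [symNab, D.nab_const_smul hc, D.cov_const_smul hc, cov_smul, smul_add]

theorem rmul_fn_mul {c : A} (hc : ∀ i, D.pd i c = 0) (η : D.OneForm) (a : D.DiffOp) :
    rmul η (D.fn c * a) = D.fn c • rmul η a := by
  ext k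
  rw [rmul, ← mul_assoc, D.fn_central hc, mul_assoc]; rfl

theorem mul_fn_mul {c : A} (hc : ∀ i, D.pd i c = 0) (a b : D.DiffOp) :
    a * (D.fn c * b) = D.fn c * (a * b) := by
  rw [← mul_assoc, D.fn_central hc, mul_assoc]

theorem fn_smul_rmul (c : A) (η : D.OneForm) (a : D.DiffOp) :
    rmul (D.fn c • η) a = D.fn c • rmul η a := by
  ext k
  exact mul_assoc _ _ _

theorem lamPow_fn_smul (c : A) (k : ℕ) (η : D.OneForm) :
    D.lamPow k (D.fn c • η) = D.fn c • D.lamPow k η :=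
  D.fn_smul_rmul c η _

theorem th_mul (c a : D.DiffOp) : D.th (c * a) = c • D.th a := by
  ext k
  rcases k with k | k | k <;> simp [th]

theorem const_smul_left_comm (r : ℂ) (c : A) (η : D.OneForm) :
    r • D.fn c • η = D.fn c • r • η := smul_comm _ _ _

theorem fcommDx_const_mul {c : A} (hc : ∀ i, D.pd i c = 0) (f : A) (i : Fin n) :
    D.fcommDx (c * f) i = D.fn c • D.fcommDx f i := by
  have h : ∑ j, D.gi i j * D.pd j (c * f) = c * ∑ j, D.gi i j * D.pd j f := by
    simp only [Derivation.leibniz, hc, smul_eq_mul, mul_zero, add_zero, Finset.mul_sum,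
      mul_left_comm]
  simp only [fcommDx, h, fn_mul, th_mul, const_smul_left_comm, lamPow_fn_smul, smul_neg]

theorem hat_const_smul {c : A} (hc : ∀ i, D.pd i c = 0) (ξ : Fin n → A) :
    D.hat (c • ξ) = D.fn c • D.hat ξ := by
  simp only [hat, Pi.smul_apply, smul_eq_mul, fn_mul, D.rmul_fn_mul hc, D.fcommDx_const_mul hc,
    ← smul_add, const_smul_left_comm, ← Finset.smul_sum]

theorem relDvFn_const_mul {c : A} (hc : ∀ i, D.pd i c = 0) (X : Fin n → A) (f : A) :
    D.relDvFn X (c * f) = D.fn c • D.relDvFn X f := by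
  have hp (i) : D.pd i (c * f) = c * D.pd i f := by
    rw [Derivation.leibniz, hc, smul_zero, add_zero, smul_eq_mul]
  have hh (i a) : D.hess (c * f) i a = c * D.hess f i a := by
    simp only [hess, hp, Derivation.leibniz, hc, mul_zero, add_zero, smul_eq_mul, mul_sub,
      Finset.mul_sum, mul_assoc]
  have h1 : (fun i => ∑ a, D.cd X a i * D.pd a (c * f))
      = c • fun i => ∑ a, D.cd X a i * D.pd a f := by
    ext i
    simp only [hp, Pi.smul_apply, smul_eq_mul, Finset.mul_sum, mul_left_comm]
  have h2 : ∑ i, ∑ j, D.fn (D.gi i j * D.pd i (c * f)) * D.vf (D.nab j X)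
      = D.fn c * ∑ i, ∑ j, D.fn (D.gi i j * D.pd i f) * D.vf (D.nab j X) := by
    simp only [hp, Finset.mul_sum, mul_left_comm _ c, D.fn_mul c, mul_assoc]
  have h3 : (∑ a, ∑ p, ∑ q, X a * D.pd p (c * f) * D.gi p q * D.Ric q a)
        + ∑ i, ∑ j, ∑ a, D.gi i j * D.cd X a j * D.hess (c * f) i a
      = c * ((∑ a, ∑ p, ∑ q, X a * D.pd p f * D.gi p q * D.Ric q a)
        + ∑ i, ∑ j, ∑ a, D.gi i j * D.cd X a j * D.hess f i a) := by
    simp only [hp, hh, mul_add, Finset.mul_sum, mul_left_comm _ c, mul_assoc]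
  simp only [relDvFn, h1, h2, h3, D.hat_const_smul hc, D.fn_mul c, th_mul, const_smul_left_comm,
    lamPow_fn_smul, smul_add]

theorem fcomm_const_mul {c : A} (hc : ∀ i, D.pd i c = 0) (f : A) (η : D.OneForm) :
    D.fcomm (c * f) η = D.fn c • D.fcomm f η := by
  have h : (fun k => D.fn (c * f) * η k - η k * D.fn (c * f))
      = D.fn c • fun k => D.fn f * η k - η k * D.fn f := by
    ext k
    simp only [Pi.smul_apply, smul_eq_mul, mul_sub, fn_mul, ← mul_assoc, D.fn_central hc]
  simp only [fcomm, h, D.fcommDx_const_mul hc, D.relDvFn_const_mul hc, fn_smul_rmul,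
    ← Finset.smul_sum, smul_add, smul_sub]

theorem lmul_const_mul {c : A} (hc : ∀ i, D.pd i c = 0) (f : A) (η : D.OneForm) :
    D.lmul (c * f) η = D.fn c • D.lmul f η := by
  simp only [lmul, fn_mul, D.rmul_fn_mul hc, D.fcomm_const_mul hc, smul_add]

theorem PForm_const_smul_left {c : A} (hc : ∀ i, D.pd i c = 0) (X Y : Fin n → A) :
    D.PForm (c • X) Y = D.fn c • D.PForm X Y := by
  -- The rules specialised to c carry this one factor outwards through products, sums and modules,
  -- without rearranging the other factors.
  simp only [PForm, D.nab_const_smul hc, D.symNab_const_smul_left hc, vf_smul, D.rmul_fn_mul hc,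
    ← Finset.smul_sum, Pi.smul_apply, smul_eq_mul, D.cd_const_smul hc,
    fun x y : A => mul_left_comm x c y, fun x y : A => mul_assoc c x y,
    fun f : Fin n → A => (Finset.mul_sum Finset.univ f c).symm, fun x y : A => (mul_add c x y).symm,
    fun x y : A => (mul_sub c x y).symm, D.fn_mul c, fun x y : D.DiffOp => mul_assoc (D.fn c) x y,
    D.mul_fn_mul hc, fun f : Fin n → D.DiffOp => (Finset.mul_sum Finset.univ f (D.fn c)).symm,
    fun x y : D.DiffOp => (mul_add (D.fn c) x y).symm, D.lmul_const_mul hc, th_mul,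
    const_smul_left_comm, lamPow_fn_smul, fun η θ : D.OneForm => (smul_add (D.fn c) η θ).symm,
    fun η θ : D.OneForm => (smul_sub (D.fn c) η θ).symm,
    fun η : D.OneForm => (smul_neg (D.fn c) η).symm]

theorem PForm_const_smul_right {c : A} (hc : ∀ i, D.pd i c = 0) (X Y : Fin n → A) :
    D.PForm X (c • Y) = D.fn c • D.PForm X Y := by
  simp only [PForm, D.nab_const_smul hc, D.symNab_const_smul_right hc, vf_smul, D.rmul_fn_mul hc,
    ← Finset.smul_sum, Pi.smul_apply, smul_eq_mul, D.cd_const_smul hc,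
    fun x y : A => mul_left_comm x c y, fun x y : A => mul_assoc c x y,
    fun f : Fin n → A => (Finset.mul_sum Finset.univ f c).symm, fun x y : A => (mul_add c x y).symm,
    fun x y : A => (mul_sub c x y).symm, D.fn_mul c, fun x y : D.DiffOp => mul_assoc (D.fn c) x y,
    D.mul_fn_mul hc, fun f : Fin n → D.DiffOp => (Finset.mul_sum Finset.univ f (D.fn c)).symm,
    fun x y : D.DiffOp => (mul_add (D.fn c) x y).symm, D.lmul_const_mul hc, th_mul,
    const_smul_left_comm, lamPow_fn_smul, fun η θ : D.OneForm => (smul_add (D.fn c) η θ).symm,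
    fun η θ : D.OneForm => (smul_sub (D.fn c) η θ).symm,
    fun η : D.OneForm => (smul_neg (D.fn c) η).symm]

theorem dvf_const_smul {c : A} (hc : ∀ i, D.pd i c = 0) (X : Fin n → A) :
    D.dvf (c • X) = D.fn c • D.dvf X := by
  have h (f : A) : D.dfn (c * f) = D.fn c • D.dfn f := by
    rw [dfn, dfn, ← D.hat_const_smul hc]
    congr 1
    ext i
    simp [hc]
  simp only [dvf, Pi.smul_apply, smul_eq_mul, h, fn_smul_rmul, D.lmul_const_mul hc, ← smul_add,
    ← Finset.smul_sum]

/-! ### Additivity of the differential -/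

theorem rmul_sub (η : D.OneForm) (a b : D.DiffOp) : rmul η (a - b) = rmul η a - rmul η b := by
  ext k; exact mul_sub _ _ _

theorem sub_rmul (η θ : D.OneForm) (a : D.DiffOp) : rmul (η - θ) a = rmul η a - rmul θ a := by
  ext k; exact sub_mul _ _ _

theorem lamPow_sub (k : ℕ) (η θ : D.OneForm) :
    D.lamPow k (η - θ) = D.lamPow k η - D.lamPow k θ := D.sub_rmul η θ _

theorem th_sub (a b : D.DiffOp) : D.th (a - b) = D.th a - D.th b := Pi.single_sub _ _ _

theorem fcommDx_sub (f h : A) (i : Fin n) :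
    D.fcommDx (f - h) i = D.fcommDx f i - D.fcommDx h i := by
  simp only [fcommDx, map_sub, mul_sub, Finset.sum_sub_distrib, fn_sub, th_sub, smul_sub,
    lamPow_sub]
  abel

theorem hat_sub (ξ ζ : Fin n → A) : D.hat (ξ - ζ) = D.hat ξ - D.hat ζ := by
  simp only [hat, Pi.sub_apply, fn_sub, rmul_sub, fcommDx_sub, ← Finset.sum_sub_distrib,
    ← smul_sub]
  refine Finset.sum_congr rfl fun i _ => congrArg _ ?_
  abel

theorem relDvFn_sub (X : Fin n → A) (f h : A) :
    D.relDvFn X (f - h) = D.relDvFn X f - D.relDvFn X h := by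
  have hh (i a) : D.hess (f - h) i a = D.hess f i a - D.hess h i a := by
    simp only [hess, map_sub, sub_mul, Finset.sum_sub_distrib]; ring
  have h1 : (fun i => ∑ a, D.cd X a i * D.pd a (f - h))
      = (fun i => ∑ a, D.cd X a i * D.pd a f) - fun i => ∑ a, D.cd X a i * D.pd a h := by
    ext i
    simp only [map_sub, Pi.sub_apply, mul_sub, Finset.sum_sub_distrib]
  have h3 (f h u v : A) : D.fn (f - h + (u - v)) = D.fn (f + u) - D.fn (h + v) := by
    rw [← fn_sub]; congr 1; abel
  simp only [relDvFn, h1]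
  simp only [hat_sub, lamPow_sub, hh, map_sub, mul_sub, sub_mul, fn_sub,
    Finset.sum_sub_distrib, th_sub, smul_sub, h3]
  abel

theorem fcomm_sub (f h : A) (η : D.OneForm) : D.fcomm (f - h) η = D.fcomm f η - D.fcomm h η := by
  have h : (fun k => D.fn (f - h) * η k - η k * D.fn (f - h))
      = (fun k => D.fn f * η k - η k * D.fn f) - fun k => D.fn h * η k - η k * D.fn h := by
    ext k
    simp only [Pi.sub_apply, fn_sub, mul_sub, sub_mul]; abel
  simp only [fcomm, h, fcommDx_sub, relDvFn_sub, sub_rmul, Finset.sum_sub_distrib]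
  abel

theorem dvf_sub (X Y : Fin n → A) : D.dvf (X - Y) = D.dvf X - D.dvf Y := by
  have h (f h : A) : D.dfn (f - h) = D.dfn f - D.dfn h := by
    rw [dfn, dfn, dfn, ← hat_sub]
    congr 1
    ext i
    simp
  simp only [dvf, Pi.sub_apply, h, sub_rmul, lmul, fn_sub, rmul_sub, fcomm_sub,
    ← Finset.sum_sub_distrib]
  exact Finset.sum_congr rfl fun i _ => by abel

/-! ### Components of 1-forms -/

theorem dx_inl (i j : Fin n) : D.dx i (Sum.inl j) = if i = j then 1 else 0 := by
  simp [dx, Pi.single_apply, eq_comm]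

theorem dx_inr (i : Fin n) (k : Fin n ⊕ Unit) : D.dx i (Sum.inr k) = 0 := by simp [dx]

theorem th_inl (a : D.DiffOp) (j : Fin n) : D.th a (Sum.inl j) = 0 := by simp [th]

theorem th_dP (a : D.DiffOp) (j : Fin n) : D.th a (Sum.inr (Sum.inl j)) = 0 := by simp [th]

theorem th_th (a : D.DiffOp) : D.th a (Sum.inr (Sum.inr ())) = a := by simp [th]

theorem lamPow_apply (hD : D.IsGeometric) (m : ℕ) (η : D.OneForm) (k) :
    D.lamPow m η k = D.lamOp ^ m * η k := by
  rw [D.lamPow_eq hD]; rfl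

theorem fcommDx_inl (f : A) (i j : Fin n) : D.fcommDx f i (Sum.inl j) = 0 := by
  simp [fcommDx, lamPow, rmul, th_inl]

theorem fcommDx_dP (f : A) (i j : Fin n) : D.fcommDx f i (Sum.inr (Sum.inl j)) = 0 := by
  simp [fcommDx, lamPow, rmul, th_dP]

theorem hat_inl (ξ : Fin n → A) (j : Fin n) : D.hat ξ (Sum.inl j) = D.fn (ξ j) := by
  simp only [hat, Finset.sum_apply, Pi.smul_apply, Pi.add_apply, rmul, fcommDx_inl, dx_inl,
    ite_mul, one_mul, zero_mul, add_zero]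
  rw [Finset.sum_eq_single j (fun i _ hi => by simp [hi]) (by simp)]
  rw [if_pos rfl, ← two_smul ℂ, smul_smul]
  norm_num

theorem hat_dP (ξ : Fin n → A) (j : Fin n) : D.hat ξ (Sum.inr (Sum.inl j)) = 0 := by
  simp [hat, rmul, fcommDx_dP, dx_inr]

/-- The symmetrisation correction comes from [ξ_i, dx^i], which carries λ. -/
theorem hat_th_modEq (hD : D.IsGeometric) (ξ : Fin n → A) :
    D.ModEq 1 (D.hat ξ (Sum.inr (Sum.inr ()))) 0 := by
  simp only [hat, Finset.sum_apply, Pi.smul_apply, Pi.add_apply, rmul, dx_inr, zero_mul, zero_add,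
    add_zero, fcommDx, Pi.neg_apply, D.lamPow_apply hD, pow_one, ← mul_neg, ← mul_smul_comm,
    ← Finset.mul_sum]
  exact D.modEq_one_zero _

theorem relDvFn_dP (X : Fin n → A) (f : A) (j : Fin n) :
    D.relDvFn X f (Sum.inr (Sum.inl j)) = 0 := by
  simp [relDvFn, lamPow, rmul, th_dP, hat_dP]

theorem fcomm_dP_of_eq_zero (f : A) (η : D.OneForm) (j : Fin n)
    (h : η (Sum.inr (Sum.inl j)) = 0) : D.fcomm f η (Sum.inr (Sum.inl j)) = 0 := by
  simp [fcomm, rmul, fcommDx_dP, relDvFn_dP, h]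

theorem lmul_dP_of_eq_zero (f : A) (η : D.OneForm) (j : Fin n)
    (h : η (Sum.inr (Sum.inl j)) = 0) : D.lmul f η (Sum.inr (Sum.inl j)) = 0 := by
  simp [lmul, rmul, D.fcomm_dP_of_eq_zero f η j h, h]

theorem dvf_dP (Z : Fin n → A) (k : Fin n) :
    D.dvf Z (Sum.inr (Sum.inl k)) = D.fn (Z k) := by
  simp only [dvf, Finset.sum_apply, Pi.add_apply, rmul, dfn, hat_dP, zero_mul, lmul, fcomm,
    Pi.sub_apply, fcommDx_dP, relDvFn_dP, Finset.sum_const_zero, zero_add, sub_zero,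
    add_sub_cancel]
  rw [Finset.sum_eq_single k]
  · simp [dP]
  · intro i _ hi
    simp [dP, hi.symm]
  · simp

theorem kerForm_inl (i j : Fin n) : D.kerForm i (Sum.inl j) = if i = j then 1 else 0 := by
  simp [kerForm, dx_inl, th_inl]

theorem kerForm_dP (i j : Fin n) : D.kerForm i (Sum.inr (Sum.inl j)) = 0 := by
  simp [kerForm, dx_inr, th_dP]

theorem kerForm_th (i : Fin n) : D.kerForm i (Sum.inr (Sum.inr ())) =
    -(D.mu⁻¹ • ∑ j, D.fn (D.gi i j) * D.P j) := by
  simp [kerForm, dx_inr, th_th]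

/-- Hence P contributes nothing to `dvfPart`, and `comm` treats it purely by the Leibniz rule. -/
theorem PForm_dP (X Y : Fin n → A) (j : Fin n) : D.PForm X Y (Sum.inr (Sum.inl j)) = 0 := by
  simp only [PForm, Pi.add_apply, Pi.sub_apply, Pi.neg_apply, Finset.sum_apply, Pi.smul_apply,
    rmul, lamPow, dx_inr, th_dP, D.lmul_dP_of_eq_zero _ _ _ (D.kerForm_dP _ j), zero_mul,
    smul_zero, Finset.sum_const_zero, neg_zero, add_zero, sub_zero]

theorem PForm_inl_modEq (hD : D.IsGeometric) (X Y : Fin n → A) (j : Fin n) :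
    D.ModEq 1 (D.PForm X Y (Sum.inl j)) (-D.vf (D.symNab X Y j)) := by
  have h : (∑ i, rmul (D.dx i) (D.vf (D.symNab X Y i)) : D.OneForm) (Sum.inl j)
      = D.vf (D.symNab X Y j) := by
    simp only [Finset.sum_apply, rmul, dx_inl, ite_mul, one_mul, zero_mul, Finset.sum_ite_eq',
      Finset.mem_univ, if_true]
  simp only [PForm, Pi.add_apply, Pi.sub_apply, Pi.neg_apply, h, Pi.smul_apply,
    D.lamPow_apply hD, th_inl, smul_zero, mul_zero, add_zero, sub_zero, pow_one]
  exact ((ModEq.refl _ _).add (D.modEq_one_zero _)).trans (.of_eq (add_zero _))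

/-- The explicit metric cancels the index lowering in `RiemLow`, and the Christoffel correction
carries λ. The transpose, harmless for commuting ∂_j, ∂_a, matches the order of indices. -/
theorem quad_curv_term (hD : D.IsGeometric) (X Y : Fin n → A) :
    D.ModEq 1 (∑ j, ∑ a,
      D.fn (∑ i, ∑ b, ∑ c, ∑ e, D.gi i j * Y b * X c * D.RiemLow e c b i * D.gi a e)
        * (D.P j * D.P a - D.vf fun k => D.lam * D.Gam k a j))
      (-D.quad (D.curvSlot Y X * D.g⁻¹)) := by
  rw [← quad_neg, ← D.quad_transpose hD, quad]
  refine .sum fun j _ => .sum fun a _ => ?_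
  have hl : D.vf (fun k => D.lam * D.Gam k a j) = D.lamOp * D.vf fun k => D.Gam k a j :=
    D.vf_smul _ _
  have hg (c b i) : ∑ e, D.gi a e * D.RiemLow e c b i = D.Riem a c b i := by
    have := congrFun (Matrix.nonsing_inv_mul_cancel_left D.g
      (Matrix.of fun d (_ : Unit) => D.Riem d c b i) hD.isUnit) a
    simpa [Matrix.mul_apply, gi, RiemLow] using congrFun this ()
  have hc : ∑ i, ∑ b, ∑ c, ∑ e, D.gi i j * Y b * X c * D.RiemLow e c b i * D.gi a e
      = (-(D.curvSlot Y X * D.g⁻¹))ᵀ j a := by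
    simp only [Matrix.transpose_apply, Matrix.neg_apply, Matrix.mul_apply, curvSlot,
      Matrix.of_apply, Finset.sum_mul, ← Finset.sum_neg_distrib]
    refine Finset.sum_congr rfl fun i _ => ?_
    rw [Finset.sum_comm]
    refine Finset.sum_congr rfl fun c _ => Finset.sum_congr rfl fun b _ => ?_
    -- Source of the sign: `curvSlot` has the free index i before the index contracted with Y.
    rw [D.Riem_antisymm a c i b, ← hg, neg_mul, neg_mul, neg_mul, neg_neg]
    simp only [Finset.sum_mul, gi]
    exact Finset.sum_congr rfl fun e _ => by ring
  rw [hc, hl]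
  refine (((ModEq.refl _ _).sub (D.modEq_one_zero _)).mul_left hD _).trans (.of_eq ?_)
  rw [sub_zero]

/-- The two products differ by a transpose and so have the same symbol. The resulting 2 cancels the
one in (2μ)⁻¹. -/
theorem quad_grad_term (hD : D.IsGeometric) (X Y : Fin n → A) :
    D.ModEq 1 (∑ i, ∑ j, D.fn (D.gi i j)
      * (D.vf (D.nab i X) * D.vf (D.nab j Y) + D.vf (D.nab i Y) * D.vf (D.nab j X)))
      ((2 : ℂ) • D.quad (D.cdMat X * D.g⁻¹ * (D.cdMat Y)ᵀ)) := by
  have h (X Y : Fin n → A) : D.ModEq 1 (∑ i, ∑ j, D.fn (D.gi i j)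
      * (D.vf (D.nab i X) * D.vf (D.nab j Y))) (D.quad (D.cdMat X * D.g⁻¹ * (D.cdMat Y)ᵀ)) := by
    refine (ModEq.sum fun i _ => ModEq.sum fun j _ =>
      D.fn_mul_vf_mul_vf hD (D.gi i j) (D.nab i X) (D.nab j Y)).trans (.of_eq ?_)
    simp only [← quad_sum]
    congr 1
    ext a b
    simp only [Matrix.sum_apply, Matrix.of_apply, Matrix.mul_apply, Matrix.transpose_apply, gi, nab,
      cdMat, Finset.sum_mul]
    rw [Finset.sum_comm]
    exact Finset.sum_congr rfl fun j _ => Finset.sum_congr rfl fun i _ => by ring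
  have ht : D.quad (D.cdMat Y * D.g⁻¹ * (D.cdMat X)ᵀ) =
      D.quad (D.cdMat X * D.g⁻¹ * (D.cdMat Y)ᵀ) := by
    rw [← D.quad_transpose hD]
    simp only [Matrix.transpose_mul, Matrix.transpose_transpose, D.gi_symm hD, mul_assoc]
  have := (h X Y).add (h Y X)
  rw [ht, ← two_smul ℂ] at this
  refine ModEq.trans (.of_eq ?_) this
  simp only [mul_add, Finset.sum_add_distrib]

theorem PForm_th_modEq (hD : D.IsGeometric) (X Y : Fin n → A) :
    D.ModEq 1 (D.PForm X Y (Sum.inr (Sum.inr ())))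
      (-D.fn (∑ a, ∑ b, Y b * X a * D.hess D.V a b) + D.mu⁻¹ • D.quad (D.quadMat X Y)) := by
  have h : (∑ i, rmul (D.dx i) (D.vf (D.symNab X Y i)) : D.OneForm) (Sum.inr (Sum.inr ()))
      = 0 := by
    simp only [Finset.sum_apply, rmul, dx_inr, zero_mul, Finset.sum_const_zero]
  simp only [PForm, Pi.add_apply, Pi.sub_apply, Pi.neg_apply, h, Pi.smul_apply,
    D.lamPow_apply hD, th_th, pow_one]
  have z (a) := D.modEq_one_zero a
  refine (((((((((ModEq.refl 1 (-0)).add (z _)).sub (.refl _ _)).add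
    ((D.quad_curv_term hD X Y).smul _)).sub ((D.quad_grad_term hD X Y).smul _)).add (z _)).add
    (z _)).add (z _)).sub (z _)).sub (z _) |>.trans (.of_eq ?_)
  have h2 : (2 * D.mu)⁻¹ * 2 = D.mu⁻¹ := by rw [mul_inv]; field_simp
  simp only [quadMat, quad_neg, quad_add, smul_smul, h2, smul_neg, smul_add]
  abel

/-! ### Commutators with vector fields to leading order -/

theorem lamOp_smul_rmul (hD : D.IsGeometric) (η : D.OneForm) (a : D.DiffOp) :
    rmul η (D.lamOp * a) = D.lamOp • rmul η a :=
  D.rmul_fn_mul hD.pd_lam η a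

theorem leibComm_lamOp_smul (hD : D.IsGeometric) (Y : Fin n → A) (η : D.OneForm) :
    D.leibComm Y (D.lamOp • η) = D.lamOp • D.leibComm Y η := by
  have h : (fun k => D.vf Y * (D.lamOp • η) k - (D.lamOp • η) k * D.vf Y)
      = D.lamOp • fun k => D.vf Y * η k - η k * D.vf Y := by
    ext k
    simp only [Pi.smul_apply, smul_eq_mul, mul_sub, ← mul_assoc, D.lamOp_central hD]
  rw [leibComm, h]
  simp only [leibComm, smul_add, Finset.smul_sum, Pi.smul_apply, smul_eq_mul,
    D.lamOp_smul_rmul hD]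

theorem leibComm_neg (Y : Fin n → A) (η : D.OneForm) :
    D.leibComm Y (-η) = -D.leibComm Y η := by
  ext k
  simp only [leibComm, rmul, Pi.add_apply, Pi.neg_apply, Finset.sum_apply, mul_neg, neg_mul,
    Finset.sum_neg_distrib]
  abel

/-- The d∂_i components of the argument come from c dW alone, so `dvfPart` is exactly cW and the
rest obeys the Leibniz rule. -/
theorem comm_smul_dvf_add (hD : D.IsGeometric) {c : A} (hc : ∀ i, D.pd i c = 0)
    (X W : Fin n → A) (η : D.OneForm) (h : ∀ j, η (Sum.inr (Sum.inl j)) = 0) :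
    D.comm X (D.fn c • D.dvf W + η) =
      D.lamOp • D.fn c • (D.dvf (D.cov X W) + D.PForm W X) + D.leibComm X η := by
  have hp : D.dvfPart (D.fn c • D.dvf W + η) = c • W := by
    ext j
    simp only [dvfPart, Pi.add_apply, h, add_zero, Pi.smul_apply, dvf_dP, smul_eq_mul, ← fn_mul]
    rw [act_fn, mul_one]
  rw [comm, hp, relVfDv, D.dvf_const_smul hc, add_sub_cancel_left, D.cov_const_smul hc,
    D.dvf_const_smul hc, D.PForm_const_smul_left hc, D.lamPow_one_eq hD, D.lamPow_one_eq hD,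
    ← smul_add, ← smul_add]

/-- An exact identity. The three differentials assemble into d(R(X,Y)Z) by the definition of `curv`
and the additivity of d. -/
theorem jacobiator_dvf (hD : D.IsGeometric) (X Y Z : Fin n → A) :
    D.jacobiator X Y (D.dvf Z) =
      D.lamOp • D.lamOp • (D.dvf (D.curv X Y Z) + D.PForm (D.cov Y Z) X - D.PForm (D.cov X Z) Y
        - D.PForm Z (D.lie X Y))
      + D.lamOp • (D.leibComm X (D.PForm Z Y) - D.leibComm Y (D.PForm Z X)) := by
  -- The inner argument -[X, dZ] is split as (-λ) d(∇_X Z) plus a remainder, so -λ must also count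
  -- as constant.
  have hl : ∀ i, D.pd i (-D.lam) = 0 := fun i => by rw [map_neg, hD.pd_lam, neg_zero]
  have h1 (X Y : Fin n → A) : D.comm Y (D.dvf Z) =
      D.fn D.lam • D.dvf (D.cov Y Z) + D.lamOp • D.PForm Z Y := by
    rw [comm_dvf, D.lamPow_one_eq hD, D.lamPow_one_eq hD]; rfl
  have h2 : -D.comm X (D.dvf Z) =
      D.fn (-D.lam) • D.dvf (D.cov X Z) + -(D.lamOp • D.PForm Z X) := by
    rw [h1 X X, neg_add, fn_neg, neg_smul]
  have h3 : D.comm (fun i => D.lam * D.lie X Y i) (D.dvf Z) =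
      D.lamOp • D.lamOp • (D.dvf (D.cov (D.lie X Y) Z) + D.PForm Z (D.lie X Y)) := by
    change D.comm (D.lam • D.lie X Y) (D.dvf Z) = _
    rw [comm_dvf, D.lamPow_one_eq hD, D.lamPow_one_eq hD, D.cov_smul,
      D.dvf_const_smul hD.pd_lam, D.PForm_const_smul_right hD.pd_lam, smul_add, smul_add]
    rfl
  have hP (X Y : Fin n → A) (j) : (D.lamOp • D.PForm X Y) (Sum.inr (Sum.inl j)) = 0 := by
    rw [Pi.smul_apply, PForm_dP, smul_zero]
  rw [jacobiator, h3, h2, h1 X Y, D.comm_smul_dvf_add hD hD.pd_lam _ _ _ (hP _ _),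
    D.comm_smul_dvf_add hD hl _ _ _ (fun j => by rw [Pi.neg_apply, hP, neg_zero]), leibComm_neg,
    D.leibComm_lamOp_smul hD, D.leibComm_lamOp_smul hD, fn_neg, ← lamOp, curv, dvf_sub, dvf_sub]
  simp only [neg_smul, smul_neg, smul_add, smul_sub]
  abel

theorem relVfForm_single_inl (hD : D.IsGeometric) (X : Fin n → A) (i j : Fin n) :
    D.relVfForm X (Pi.single i 1) (Sum.inl j) =
      D.lamOp * D.fn (-∑ a, X a * D.Gam i j a) := by
  have h (a) : D.cdForm (Pi.single i 1) j a = -D.Gam i j a := by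
    have : D.pd a ((Pi.single i 1 : Fin n → A) j) = 0 := by
      rcases eq_or_ne j i with rfl | h <;> simp [*]
    rw [cdForm, this, Finset.sum_eq_single i (fun c _ hc => by simp [hc]) (by simp)]
    simp
  simp only [relVfForm, Pi.sub_apply, D.lamPow_apply hD, pow_one, hat_inl, Pi.smul_apply, th_inl,
    smul_zero, mul_zero, sub_zero, h, mul_neg, Finset.sum_neg_distrib]

theorem relVfForm_dP (X ξ : Fin n → A) (j : Fin n) :
    D.relVfForm X ξ (Sum.inr (Sum.inl j)) = 0 := by
  simp [relVfForm, lamPow, rmul, hat_dP, th_dP]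

/-- The hatted term already has an outer λ and its θ' part brings another, so it disappears modulo
λ² along with the explicit λ² term. -/
theorem relVfForm_single_th (hD : D.IsGeometric) (X : Fin n → A) (i : Fin n) :
    D.ModEq 2 (D.relVfForm X (Pi.single i 1) (Sum.inr (Sum.inr ())))
      (D.lamOp * -(D.mu⁻¹ • ∑ j, D.fn (D.gi i j) * D.vf (D.nab j X))) := by
  have h : ∑ k, ∑ j, D.fn (D.gi k j * (Pi.single i 1 : Fin n → A) k) * D.vf (D.nab j X)
      = ∑ j, D.fn (D.gi i j) * D.vf (D.nab j X) := by
    rw [Finset.sum_eq_single i (fun k _ hk => by simp [hk, fn_zero]) (by simp)]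
    simp
  simp only [relVfForm, Pi.sub_apply, D.lamPow_apply hD, pow_one, Pi.smul_apply, th_th, h]
  refine ((((D.hat_th_modEq hD _).lamOp_mul.sub (.refl _ _)).sub (D.modEq_zero 2 _))).trans
    (.of_eq ?_)
  rw [mul_zero, zero_sub, sub_zero, mul_neg]

theorem leibComm_dP (X : Fin n → A) (η : D.OneForm) (h : ∀ j, η (Sum.inr (Sum.inl j)) = 0)
    (j : Fin n) : D.leibComm X η (Sum.inr (Sum.inl j)) = 0 := by
  simp [leibComm, rmul, h, relVfForm_dP]

/-- Two sources of order λ: the Lie bracket of X with the coefficient of dx^j, and the Christoffel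
part of each [X, dx^i]. Together they form `lieEnd`. -/
theorem leibComm_inl_modEq (hD : D.IsGeometric) (X : Fin n → A) (η : D.OneForm)
    (h : ∀ j, η (Sum.inr (Sum.inl j)) = 0) (S : Matrix (Fin n) (Fin n) A)
    (hS : ∀ i, D.ModEq 1 (η (Sum.inl i)) (-D.vf fun b => S b i)) (j : Fin n) :
    D.ModEq 2 (D.leibComm X η (Sum.inl j)) (D.lamOp * -D.vf fun b => D.lieEnd X S b j) := by
  have h1 : D.BracketEq X (η (Sum.inl j)) (-D.vf (D.lie X fun b => S b j)) :=
    (D.bracketEq_vf hD X _).neg.congr_left hD (hS j)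
  have h2 : D.ModEq 2 (∑ i, D.lamOp * D.fn (-∑ a, X a * D.Gam i j a) * η (Sum.inl i))
      (∑ i, D.lamOp * (D.fn (-∑ a, X a * D.Gam i j a) * -D.vf fun b => S b i)) := by
    refine .sum fun i _ => ?_
    rw [mul_assoc]
    exact ((hS i).mul_left hD _).lamOp_mul
  simp only [leibComm, Pi.add_apply, Finset.sum_apply, rmul, h, mul_zero, Finset.sum_const_zero,
    add_zero, D.relVfForm_single_inl hD]
  refine (h2.add h1).trans (.of_eq ?_)
  rw [← Finset.mul_sum, ← mul_add]
  congr 1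
  simp only [mul_neg, ← vf_smul, Finset.sum_neg_distrib, ← vf_sum, ← neg_add, ← vf_add]
  congr 2
  ext b
  simp only [D.lieEnd_apply hD, Pi.add_apply, Finset.sum_apply, Pi.smul_apply, smul_eq_mul,
    neg_mul, Finset.sum_neg_distrib]
  ring

/-- Besides [X, ·] on the θ' coefficient, the θ' part of [X, dx^i] multiplies the dx^i coefficient.
This cross term is ∇X g⁻¹ Sᵀ. -/
theorem leibComm_th_modEq (hD : D.IsGeometric) (X : Fin n → A) (η : D.OneForm)
    (h : ∀ j, η (Sum.inr (Sum.inl j)) = 0) (S Q : Matrix (Fin n) (Fin n) A) (F : A)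
    (hS : ∀ i, D.ModEq 1 (η (Sum.inl i)) (-D.vf fun b => S b i))
    (hQ : D.ModEq 1 (η (Sum.inr (Sum.inr ()))) (-D.fn F + D.mu⁻¹ • D.quad Q)) :
    D.ModEq 2 (D.leibComm X η (Sum.inr (Sum.inr ())))
      (D.lamOp * (-D.fn (D.dir X F)
        + D.mu⁻¹ • D.quad (D.lieBiv X Q + D.cdMat X * D.g⁻¹ * Sᵀ))) := by
  have h1 : D.BracketEq X (η (Sum.inr (Sum.inr ())))
      (-D.fn (D.dir X F) + D.mu⁻¹ • D.quad (D.lieBiv X Q)) :=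
    ((D.bracketEq_fn X F).neg.add ((D.bracketEq_quad hD X Q).smul _)).congr_left hD hQ
  have h2 (i : Fin n) : D.ModEq 2
      (D.relVfForm X (Pi.single i 1) (Sum.inr (Sum.inr ())) * η (Sum.inl i))
      (D.lamOp * (D.mu⁻¹ • ∑ j, D.quad (Matrix.of fun a b => D.gi i j * D.cd X a j * S b i))) := by
    refine ((D.relVfForm_single_th hD X i).mul_right _).trans ?_
    rw [mul_assoc]
    refine ModEq.lamOp_mul (((hS i).mul_left hD _).trans ?_)
    rw [neg_mul_neg, smul_mul_assoc, Finset.sum_mul]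
    refine ModEq.smul _ (ModEq.sum fun j _ => ?_)
    rw [mul_assoc]
    exact D.fn_mul_vf_mul_vf hD _ _ _
  simp only [leibComm, Pi.add_apply, Finset.sum_apply, rmul, h, mul_zero, Finset.sum_const_zero,
    add_zero]
  refine ((ModEq.sum fun i _ => h2 i).add h1).trans (.of_eq ?_)
  rw [← Finset.mul_sum, ← mul_add, ← Finset.smul_sum]
  congr 1
  have h3 : ∑ i, ∑ j, D.quad (Matrix.of fun a b => D.gi i j * D.cd X a j * S b i)
      = D.quad (D.cdMat X * D.g⁻¹ * Sᵀ) := by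
    simp only [← quad_sum]
    congr 1
    ext a b
    simp only [Matrix.sum_apply, Matrix.of_apply, Matrix.mul_apply, Matrix.transpose_apply,
      cdMat, Finset.sum_mul]
    refine Finset.sum_congr rfl fun i _ => Finset.sum_congr rfl fun j _ => ?_
    have : D.gi i j = D.g⁻¹ j i := congrFun (congrFun (D.gi_symm hD).symm i) j
    rw [this]; ring
  rw [h3, quad_add, smul_add]
  abel

theorem relVfDv_modEq_zero (hD : D.IsGeometric) (Y X : Fin n → A) (k) :
    D.ModEq 1 (D.relVfDv Y X k) 0 := by
  simp only [relVfDv, Pi.add_apply, D.lamPow_apply hD, pow_one, ← mul_add]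
  exact D.modEq_one_zero _

theorem relVfForm_modEq_zero (hD : D.IsGeometric) (X ξ : Fin n → A) (k) :
    D.ModEq 1 (D.relVfForm X ξ k) 0 := by
  simp only [relVfForm, Pi.sub_apply, D.lamPow_apply hD, pow_succ, pow_zero, one_mul, mul_assoc,
    ← mul_sub]
  exact D.modEq_one_zero _

/-- Every defining relation carries a factor λ, and the algebra itself is commutative modulo λ. -/
theorem comm_modEq_zero (hD : D.IsGeometric) (X : Fin n → A) (η : D.OneForm) (k) :
    D.ModEq 1 (D.comm X η k) 0 := by
  have hz {ι : Type} (s : Finset ι) (f g : ι → D.DiffOp) (hf : ∀ i ∈ s, D.ModEq 1 (f i) 0) :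
      D.ModEq 1 (∑ i ∈ s, f i * g i) 0 :=
    (ModEq.sum fun i hi => (hf i hi).mul_right (g i)).trans (.of_eq (by simp))
  have h0 (a : D.DiffOp) : D.ModEq 1 (D.vf X * a - a * D.vf X) 0 :=
    ((D.mul_comm_modEq hD _ _).sub (.refl _ _)).trans (.of_eq (sub_self _))
  simp only [comm, leibComm, Pi.add_apply, Finset.sum_apply, rmul]
  refine ((D.relVfDv_modEq_zero hD _ _ _).add (((hz _ _ _ fun i _ =>
    D.relVfForm_modEq_zero hD _ _ _).add (hz _ _ _ fun i _ =>
    D.relVfDv_modEq_zero hD _ _ _)).add (h0 _))).trans (.of_eq (by simp))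

theorem vmul_modEq (hD : D.IsGeometric) (X : Fin n → A) (η : D.OneForm) (k) :
    D.ModEq 1 (D.vmul X η k) (η k * D.vf X) :=
  ((ModEq.refl 1 _).add (D.comm_modEq_zero hD X η k)).trans (.of_eq (add_zero _))

/-- Under the prefactor λ², left and right products agree modulo λ³, so the kernel form gives the
symbol -μ⁻¹ g^{ij} ∂_j C_i. -/
theorem sum_vmul_kerForm_th (hD : D.IsGeometric) (C : Fin n → Fin n → A)
    (M : Matrix (Fin n) (Fin n) A) (hM : ∀ i b, C i b = M b i) :
    D.ModEq 1 (∑ i, D.vmul (C i) (D.kerForm i) (Sum.inr (Sum.inr ())))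
      (D.mu⁻¹ • D.quad (-(M * D.g⁻¹))) := by
  have h (i : Fin n) : D.ModEq 1 (D.vmul (C i) (D.kerForm i) (Sum.inr (Sum.inr ())))
      (-(D.mu⁻¹ • ∑ j, D.quad (Matrix.of fun a b =>
        D.gi i j * (Pi.single j 1 : Fin n → A) a * C i b))) := by
    refine (D.vmul_modEq hD _ _ _).trans ?_
    rw [kerForm_th, neg_mul, smul_mul_assoc, Finset.sum_mul]
    refine (ModEq.smul _ (ModEq.sum fun j _ => ?_)).neg
    rw [mul_assoc, ← vf_single]
    exact D.fn_mul_vf_mul_vf hD _ _ _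
  refine (ModEq.sum fun i _ => h i).trans (.of_eq ?_)
  rw [Finset.sum_neg_distrib, ← Finset.smul_sum, ← smul_neg]
  congr 1
  rw [quad_neg, ← D.quad_transpose hD (M * _)]
  simp only [← quad_sum]
  congr 2
  ext a b
  simp only [Matrix.sum_apply, Matrix.of_apply, Matrix.mul_apply, Matrix.transpose_apply, hM]
  refine Finset.sum_congr rfl fun i _ => ?_
  rw [Finset.sum_eq_single a (fun j _ hj => by simp [hj.symm]) (by simp)]
  simp [gi, mul_comm]

theorem sum_vmul_kerForm_inl (hD : D.IsGeometric) (C : Fin n → Fin n → A) (j : Fin n) :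
    D.ModEq 1 (∑ i, D.vmul (C i) (D.kerForm i) (Sum.inl j)) (D.vf (C j)) := by
  refine (ModEq.sum fun i _ => D.vmul_modEq hD (C i) (D.kerForm i) _).trans (.of_eq ?_)
  simp only [kerForm_inl, ite_mul, one_mul, zero_mul, Finset.sum_ite_eq', Finset.mem_univ, if_true]

theorem sum_vmul_kerForm_dP (hD : D.IsGeometric) (C : Fin n → Fin n → A) (j : Fin n) :
    D.ModEq 1 (∑ i, D.vmul (C i) (D.kerForm i) (Sum.inr (Sum.inl j))) 0 := by
  refine (ModEq.sum fun i _ => D.vmul_modEq hD (C i) (D.kerForm i) _).trans (.of_eq ?_)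
  simp only [kerForm_dP, zero_mul, Finset.sum_const_zero]

/-! ### The Jacobiator modulo λ³, component by component -/

theorem jacobiator_inl_modEq (hD : D.IsGeometric) (X Y Z : Fin n → A) (j : Fin n) :
    D.ModEq 3 (D.jacobiator X Y (D.dvf Z) (Sum.inl j))
      (D.lamOp ^ 2 * (D.dvf (D.curv X Y Z) (Sum.inl j) - D.vf (D.nab j (D.curv X Y Z))
        + D.vf (D.curvCoeff X Y Z j))) := by
  have hS (X Y : Fin n → A) (j : Fin n) := D.PForm_inl_modEq hD X Y j
  have hL (X Y : Fin n → A) (j : Fin n) := D.leibComm_inl_modEq hD X (D.PForm Z Y) (D.PForm_dP Z Y)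
    (D.symMat Z Y) (fun i => (hS Z Y i).trans (.of_eq (by
      congr 2; ext b; exact D.symNab_apply Z Y i b))) j
  rw [D.jacobiator_dvf hD]
  simp only [Pi.add_apply, Pi.smul_apply, Pi.sub_apply, smul_eq_mul]
  -- P is known modulo λ under a factor λ², and the Leibniz commutators modulo λ² under a factor λ;
  -- both errors are of order λ³.
  refine ((((((ModEq.refl 1 _).add (hS _ _ j)).sub (hS _ _ j)).sub
    (hS _ _ j)).lamOp_mul.lamOp_mul).add (((hL X Y j).sub (hL Y X j)).lamOp_mul)).trans (.of_eq ?_)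
  rw [← mul_sub, ← mul_add, ← mul_add, ← mul_assoc, ← pow_two]
  congr 1
  have key := D.symMat_jacobi hD X Y Z
  have hv : -D.symNab (D.cov Y Z) X j + D.symNab (D.cov X Z) Y j + D.symNab Z (D.lie X Y) j
      - (fun b => D.lieEnd X (D.symMat Z Y) b j) + (fun b => D.lieEnd Y (D.symMat Z X) b j)
      = -D.nab j (D.curv X Y Z) + D.curvCoeff X Y Z j := by
    ext b
    have := congrArg (fun M : Matrix (Fin n) (Fin n) A => M b j) key
    simp only [Matrix.add_apply, Matrix.sub_apply, Matrix.neg_apply] at this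
    simp only [Pi.add_apply, Pi.sub_apply, Pi.neg_apply, symNab_apply, curvCoeff_apply]
    exact this
  have hv' := congrArg D.vf hv
  simp only [vf_add, vf_sub, vf_neg] at hv'
  rw [sub_eq_add_neg (D.dvf _ _) (D.vf _), add_assoc (D.dvf _ _) (-_), ← hv']
  abel

theorem jacobiator_dP (hD : D.IsGeometric) (X Y Z : Fin n → A) (j : Fin n) :
    D.jacobiator X Y (D.dvf Z) (Sum.inr (Sum.inl j)) =
      D.lamOp ^ 2 * D.dvf (D.curv X Y Z) (Sum.inr (Sum.inl j)) := by
  rw [D.jacobiator_dvf hD]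
  simp only [Pi.add_apply, Pi.smul_apply, Pi.sub_apply, smul_eq_mul, PForm_dP,
    D.leibComm_dP _ _ (D.PForm_dP _ _), add_zero, sub_zero, mul_zero, pow_two, mul_assoc]

theorem jacobiator_th_modEq (hD : D.IsGeometric) (X Y Z : Fin n → A) :
    D.ModEq 3 (D.jacobiator X Y (D.dvf Z) (Sum.inr (Sum.inr ())))
      (D.lamOp ^ 2 * (D.dvf (D.curv X Y Z) (Sum.inr (Sum.inr ()))
        + D.fn (D.dir (D.curv X Y Z) D.V)
        + D.mu⁻¹ • D.quad (-(D.curvCoeffMat X Y Z * D.g⁻¹)))) := by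
  have hS (X Y : Fin n → A) (j : Fin n) := D.PForm_inl_modEq hD X Y j
  have hQ (X Y : Fin n → A) := D.PForm_th_modEq hD X Y
  have hL (X Y : Fin n → A) := D.leibComm_th_modEq hD X (D.PForm Z Y) (D.PForm_dP Z Y)
    (D.symMat Z Y) (D.quadMat Z Y) _ (fun i => (hS Z Y i).trans (.of_eq (by
      congr 2; ext b; exact D.symNab_apply Z Y i b))) (hQ Z Y)
  rw [D.jacobiator_dvf hD]
  simp only [Pi.add_apply, Pi.smul_apply, Pi.sub_apply, smul_eq_mul]
  refine ((((((ModEq.refl 1 _).add (hQ _ _)).sub (hQ _ _)).sub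
    (hQ _ _)).lamOp_mul.lamOp_mul).add (((hL X Y).sub (hL Y X)).lamOp_mul)).trans (.of_eq ?_)
  rw [← mul_sub, ← mul_add, ← mul_add, ← mul_assoc, ← pow_two]
  congr 1
  -- K and Kᵀ define the same operator, so their difference drops out once `quad` is applied.
  obtain ⟨K, hK⟩ := D.quadMat_jacobi hD X Y Z
  have hV := congrArg D.fn (D.dir_curv hD D.V X Y Z)
  have hK' := congrArg (fun M => D.mu⁻¹ • D.quad M) hK
  simp only [quad_add, quad_sub, D.quad_transpose hD, sub_self, add_zero, smul_add,
    smul_sub] at hK'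
  simp only [fn_add, fn_sub, fn_neg] at hV
  rw [hV, ← hK']
  simp only [quad_add, smul_add]
  abel

/-- The Jacobiator of two vector fields and the differential of a vector field. -/
theorem exists_jacobiator_dvf_eq (hD : D.IsGeometric) (X Y Z : Fin n → A) :
    ∃ w : D.OneForm, D.jacobiator X Y (D.dvf Z) =
      D.lamPow 2 (D.dvf (D.curv X Y Z))
        - D.lamPow 2 (∑ i, rmul (D.dx i) (D.vf (D.nab i (D.curv X Y Z))))
        + D.lamPow 2 (D.th (D.fn (∑ k, D.curv X Y Z k * D.pd k D.V)))
        + D.lamPow 2 (∑ i, D.vmul (D.curvCoeff X Y Z i) (D.kerForm i))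
        + D.lamPow 3 w := by
  suffices h : ∀ k, D.ModEq 3 (D.jacobiator X Y (D.dvf Z) k)
      ((D.lamPow 2 (D.dvf (D.curv X Y Z))
        - D.lamPow 2 (∑ i, rmul (D.dx i) (D.vf (D.nab i (D.curv X Y Z))))
        + D.lamPow 2 (D.th (D.fn (∑ k, D.curv X Y Z k * D.pd k D.V)))
        + D.lamPow 2 (∑ i, D.vmul (D.curvCoeff X Y Z i) (D.kerForm i)) : D.OneForm) k) by
    choose w hw using h
    refine ⟨w, funext fun k => ?_⟩
    rw [Pi.add_apply, D.lamPow_apply hD 3, ← hw, add_sub_cancel]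
  rintro (j | j | ⟨⟩)
  all_goals
    simp only [Pi.add_apply, Pi.sub_apply, D.lamPow_apply hD, Finset.sum_apply, rmul, dx_inr,
      dx_inl, th_inl, th_dP, zero_mul, Finset.sum_const_zero, mul_zero, sub_zero, add_zero,
      ite_mul, one_mul, Finset.sum_ite_eq', Finset.mem_univ, if_true, ← mul_add, ← mul_sub]
  · exact (D.jacobiator_inl_modEq hD X Y Z j).trans
      (((ModEq.refl 1 _).add (D.sum_vmul_kerForm_inl hD _ j).symm).lamOp_pow_mul 2)
  · rw [D.jacobiator_dP hD]
    refine ModEq.lamOp_pow_mul (m := 1) 2 ?_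
    exact (ModEq.of_eq (add_zero _).symm).trans
      ((ModEq.refl _ _).add (D.sum_vmul_kerForm_dP hD _ j).symm)
  · exact (D.jacobiator_th_modEq hD X Y Z).trans (((ModEq.refl 1 _).add
      (D.sum_vmul_kerForm_th hD _ _ (D.curvCoeff_apply X Y Z)).symm).lamOp_pow_mul 2)

end

end LocalData

noncomputable section

/-! ### The data of a patch are geometric -/

section Patch

variable {n : ℕ} (U : Opens (EuclideanSpace ℝ (Fin n)))

theorem partialD_apply (i : Fin n) (f : smoothFn U) (u : U) :
    (partialD U i f : U → ℂ) u =
      fderiv ℝ (extendZero U f) (u : EuclideanSpace ℝ (Fin n)) (EuclideanSpace.single i 1) := rfl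

/-- Symmetry of the second derivative of a smooth function. The extension by zero is harmless
because U is open and only germs at its points count. -/
theorem partialD_comm (i j : Fin n) (f : smoothFn U) :
    partialD U i (partialD U j f) = partialD U j (partialD U i f) := by
  have h (i j : Fin n) (u : U) : (partialD U i (partialD U j f) : U → ℂ) u =
      fderiv ℝ (fderiv ℝ (extendZero U f)) (u : EuclideanSpace ℝ (Fin n))
        (EuclideanSpace.single i 1) (EuclideanSpace.single j 1) := by
    have he : extendZero U (partialD U j f : U → ℂ)
        =ᶠ[nhds (u : EuclideanSpace ℝ (Fin n))]
          fun x => fderiv ℝ (extendZero U f) x (EuclideanSpace.single j 1) := by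
      filter_upwards [U.isOpen.mem_nhds u.2] with x hx
      exact extendZero_coe U _ ⟨x, hx⟩
    have hd : DifferentiableAt ℝ (fderiv ℝ (extendZero U f)) (u : EuclideanSpace ℝ (Fin n)) :=
      ((f.2.fderiv_of_isOpen (m := ∞) U.isOpen (by simp)).contDiffAt
        (U.isOpen.mem_nhds u.2)).differentiableAt (by simp)
    rw [partialD_apply, he.fderiv_eq, fderiv_clm_apply hd (differentiableAt_const _)]
    simp
  ext u
  rw [h, h]
  exact ((f.2.contDiffAt (U.isOpen.mem_nhds u.2)).isSymmSndFDerivAt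
    (by simpa using WithTop.coe_le_coe.2 (le_top : (2 : ℕ∞) ≤ ⊤))).eq _ _

theorem isUnit_of_forall_ne_zero (f : smoothFn U) (hf : ∀ u, (f : U → ℂ) u ≠ 0) : IsUnit f := by
  have hF : ContDiffOn ℝ ∞ (fun x => (extendZero U f x)⁻¹) U := by
    refine ContDiffOn.inv f.2 fun x hx => ?_
    have := extendZero_coe U f ⟨x, hx⟩
    rw [show extendZero U f x = (f : U → ℂ) ⟨x, hx⟩ from this]
    exact hf _
  refine IsUnit.of_mul_eq_one (smoothFn.mk' U _ hF) ?_
  ext u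
  change (f : U → ℂ) u * (extendZero U f u)⁻¹ = 1
  rw [extendZero_coe, mul_inv_cancel₀ (hf u)]

theorem patchData_isGeometric (g : Matrix (Fin n) (Fin n) (smoothFn U)) (V : smoothFn U) (μ : ℝ)
    (hs : ∀ i j, g i j = g j i) (hg : IsUnit g.det) : (patchData U g V μ).IsGeometric where
  pd_lam i := by
    refine Polynomial.ext fun k => ?_
    change partialD U i ((Polynomial.X : (smoothFn U)[X]).coeff k) = 0
    -- The coefficients of the formal variable are the constants 0 and 1, which every derivation
    -- annihilates.
    rw [Polynomial.coeff_X]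
    split_ifs
    · exact (partialD U i).map_one_eq_zero
    · exact map_zero _
  pd_comm i j f := Polynomial.ext fun k => partialD_comm U i j (f.coeff k)
  symm i j := congrArg Polynomial.C (hs i j)
  isUnit := by
    change IsUnit ((Polynomial.C : smoothFn U →+* (smoothFn U)[X]).mapMatrix g).det
    rw [← RingHom.map_det]
    exact hg.map _

end Patch

section Components

variable {n : ℕ} {M : Type*} [TopologicalSpace M] [ChartedSpace (EuclideanSpace ℝ (Fin n)) M]
  [IsManifold (𝓡 n) ∞ M]

attribute [local instance] chartedSpaceSelf

theorem SmoothChart.tangentVec_bijective (φ : SmoothChart (EuclideanSpace ℝ (Fin n)) M)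
    {u : EuclideanSpace ℝ (Fin n)} (hu : u ∈ φ.1.target) :
    Function.Bijective fun e => φ.tangentVec e u := by
  have h1 : φ.1 ∈ IsManifold.maximalAtlas (𝓡 n) 1 M :=
    IsManifold.maximalAtlas_subset_of_le (by simp) φ.2
  have hφ : φ.1.MDifferentiable (𝓡 n) (𝓡 n) :=
    ⟨fun x hx => (mdifferentiableAt_of_mem_maximalAtlas h1 hx).mdifferentiableWithinAt,
      fun x hx => (mdifferentiableAt_symm_of_mem_maximalAtlas h1 hx).mdifferentiableWithinAt⟩
  exact hφ.symm.mfderiv_bijective hu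

/-- A smooth function without zeros is invertible, so nonvanishing can be checked pointwise. There,
a kernel vector of the Gram matrix would be a nonzero tangent vector orthogonal to everything. -/
theorem SmoothChart.isUnit_det_metric (φ : SmoothChart (EuclideanSpace ℝ (Fin n)) M)
    (g : PseudoRiemannianMetric (EuclideanSpace ℝ (Fin n)) M) : IsUnit (φ.metric g).det := by
  refine isUnit_of_forall_ne_zero _ _ fun u => ?_
  let N : Matrix (Fin n) (Fin n) ℝ := Matrix.of fun i j =>
    g.inner (φ.1.symm u) (φ.tangentVec (EuclideanSpace.single i 1) u)
      (φ.tangentVec (EuclideanSpace.single j 1) u)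
  have hN : ((φ.metric g).det : φ.range → ℂ) u = (N.det : ℂ) := by
    let ev : smoothFn φ.range →+* ℂ := (Pi.evalRingHom _ u).comp (smoothFn φ.range).val.toRingHom
    change ev (φ.metric g).det = Complex.ofRealHom N.det
    rw [RingHom.map_det, RingHom.map_det]
    rfl
  rw [hN, Complex.ofReal_ne_zero]
  intro h0
  obtain ⟨v, hv, hv0⟩ := Matrix.exists_vecMul_eq_zero_iff.2 h0
  have hbij := φ.tangentVec_bijective u.2
  let T : EuclideanSpace ℝ (Fin n) →L[ℝ] TangentSpace (𝓡 n) (φ.1.symm u) :=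
    mfderiv (𝓡 n) (𝓡 n) φ.1.symm (u : EuclideanSpace ℝ (Fin n))
  have hsum (e : EuclideanSpace ℝ (Fin n)) : e = ∑ i, e i • EuclideanSpace.single i (1 : ℝ) := by
    simpa using ((EuclideanSpace.basisFun (Fin n) ℝ).sum_repr e).symm
  -- The chart differential T is onto, so testing against the images of the coordinate basis is
  -- enough for nondegeneracy; its injectivity then gives v = 0.
  have hT : T (∑ i, v i • EuclideanSpace.single i (1 : ℝ)) = 0 := by
    refine g.nondegenerate _ _ fun w => ?_
    obtain ⟨e, rfl⟩ := hbij.2 w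
    change g.inner _ _ (T e) = 0
    rw [hsum e]
    simp only [map_sum, map_smul, sum_apply, smul_apply]
    refine Finset.sum_eq_zero fun j _ => ?_
    have := congrFun hv0 j
    simp only [Matrix.vecMul, dotProduct, Pi.zero_apply] at this
    rw [← mul_zero (e j), ← this]
    rfl
  have h2 : ∑ i, v i • EuclideanSpace.single i (1 : ℝ) = 0 :=
    hbij.1 (hT.trans (map_zero T).symm)
  refine hv (funext fun i => ?_)
  have := congrArg (fun e : EuclideanSpace ℝ (Fin n) => e i) h2
  simpa [Pi.single_apply] using this

theorem SmoothChart.calculus_isGeometric (φ : SmoothChart (EuclideanSpace ℝ (Fin n)) M)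
    (g : PseudoRiemannianMetric (EuclideanSpace ℝ (Fin n)) M) (V : C^∞⟮𝓡 n, M; ℝ⟯) (μ : ℝ) :
    (φ.calculus g V μ).IsGeometric :=
  patchData_isGeometric _ _ _ _ (fun _ _ => Subtype.ext (funext fun _ =>
    congrArg Complex.ofReal (g.symm _ _ _))) (φ.isUnit_det_metric g)

end Components

end

end QuantumCalculus

theorem proposition4p3 {n : ℕ} {M : Type*} [TopologicalSpace M]
    [ChartedSpace (EuclideanSpace ℝ (Fin n)) M] [IsManifold (𝓡 n) ∞ M]
    (g : QuantumCalculus.PseudoRiemannianMetric (EuclideanSpace ℝ (Fin n)) M)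
    (V : C^∞⟮𝓡 n, M; ℝ⟯) (μ : ℝ) (hμ : μ ≠ 0)
    (X Y Z : QuantumCalculus.SmoothVectorField (EuclideanSpace ℝ (Fin n)) M)
    (φ : QuantumCalculus.SmoothChart (EuclideanSpace ℝ (Fin n)) M) :
    let D := φ.calculus g V μ
    let x := φ.comps X
    let y := φ.comps Y
    let z := φ.comps Z
    let U := D.curv x y z
    ∃ w : D.OneForm, D.jacobiator x y (D.dvf z) =
      D.lamPow 2 (D.dvf U)
        - D.lamPow 2 (∑ i, QuantumCalculus.LocalData.rmul (D.dx i) (D.vf (D.nab i U)))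
        + D.lamPow 2 (D.th (D.fn (∑ k, U k * D.pd k D.V)))
        + D.lamPow 2 (∑ i, D.vmul (D.curvCoeff x y z i) (D.kerForm i))
        + D.lamPow 3 w := by
  intro D x y z U
  exact QuantumCalculus.LocalData.exists_jacobiator_dvf_eq D (φ.calculus_isGeometric g V μ) x y z
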